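/- **Setting.** For $a,b\in\mathbb R$ let $\rho^{(a,b)}(x)=(1-x)^a x^b$ on $(0,1)$, $\|v\|_{\rho^{(a,b)}}^2=\int_0^1\rho^{(a,b)}v^2\,dx$, and let $L^2_{\rho^{(a,b)}}(0,1)$ be the space of measurable $v$ with $\|v\|_{\rho^{(a,b)}}<\infty$. For $m\in\mathbb N=\{0,1,2,\dots\}$ put $$|v|_{m,\rho^{(a,b)},A}=\|D^m v\|_{\rho^{(a+m,b+m)}},\qquad \|v\|_{m,\rho^{(a,b)},A}=\Big(\sum_{l=0}^m\|D^l v\|^2_{\rho^{(a+l,b+l)}}\Big)^{1/2},$$ with weak derivatives $D^l$ on $(0,1)$ (the value is $+\infty$ if a weak derivative does not exist). Let $G_n^{(a,b)}(t)=P_n^{(a,b)}(2t-1)$ be the Jacobi polynomials shifted to $(0,1)$, and $|||G_n^{(a,b)}|||^2=\int_0^1\rho^{(a,b)}(G_n^{(a,b)})^2\,dt$. Let $1<\alpha<2$, $\tfrac12\le r\le1$, and let $\beta\in[\alpha-1,1]$ be determined by $r=\dfrac{\sin\pi\beta}{\sin\pi(\alpha-\beta)+\sin\pi\beta}$. Let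 $$\lambda_n=\frac{\sin\pi\alpha}{\sin\pi(\alpha-\beta)+\sin\pi\beta}\,\frac{\Gamma(n+\alpha)}{n!}\ (n\ge0),\qquad \lambda_{-1}=-\frac{\Gamma(\alpha)\sin\pi\alpha}{\sin\pi(\alpha-\beta)+\sin\pi\beta},$$ and $k(x)=(1-x)^{\alpha-\beta-1}x^{\beta-1}$. For $f\in L^2_{\rho^{(\beta-1,\alpha-\beta-1)}}(0,1)$ and $N\in\mathbb N$ let $$f_i=\int_0^1\rho^{(\beta-1,\alpha-\beta-1)}f\,G_i^{(\beta-1,\alpha-\beta-1)}dx,\qquad c_i=\frac{f_{i+1}}{\lambda_i\,|||G_{i+1}^{(\beta-1,\alpha-\beta-1)}|||^2}\quad(i\ge-1),$$ $$q_N(x)=c_{-1}\,x\,k(x)+\rho^{(\alpha-\beta,\beta)}(x)\sum_{i=0}^{N-1}c_i\,G_i^{(\alpha-\beta,\beta)}(x),$$ and let $q$ be the limit of $q_N$, in the sense that $q-c_{-1}xk=\lim_{N\to\infty}(q_N-c_{-1}xk)$ in $L^2_{\rho^{(-(\alpha-\beta),-\beta)}}(0,1)$. **Statement.** Let $\tfrac12\le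 r\le 1$, let $j,\mu\in\mathbb N$ with $0\le\mu\le j$, and let $\alpha_0\ge1$, with $\alpha_0>1$ if $r=\tfrac12$. There is a constant $C>0$, depending only on $r,j,\mu,\alpha_0$, such that for all $\alpha\in(1,2)$ with $\alpha\ge\alpha_0$, for $\beta$ as above, and for every $f\in L^2_{\rho^{(\beta-1,\alpha-\beta-1)}}(0,1)$ whose weak derivative $D^jf$ exists and lies in $L^2_{\rho^{(\beta+j-1,\alpha-\beta+j-1)}}(0,1)$, the limit $q$ exists and, for all integers $N\ge1$ with $N\ge j-1$, $$\Big\|\frac{q-q_N}{\rho^{(\alpha-\beta,\beta)}}\Big\|_{\mu,\rho^{(\alpha-\beta,\beta)},A}\le C\,N^{-(\alpha-1)}\,\big(N(N+\alpha-2)\big)^{\frac{\mu-j}2}\,|f|_{j,\rho^{(\beta-1,\alpha-\beta-1)},A}.$$ In particular $C$ is independent of $N$ and $f$, and, if $r>\tfrac12$ (take $\alpha_0=1$), also of $\alpha$. -/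

import Mathlib

open MeasureTheory Set Filter Topology
open scoped ENNReal ContDiff

namespace FracSpectral

noncomputable section

/-- The weight `ρ^{(a,b)}(x) = (1 - x)^a x^b` on `(0,1)`. -/
def rho (a b x : ℝ) : ℝ := (1 - x) ^ a * x ^ b

/-- The norm of `L²_{ρ^{(a,b)}}(0,1)`, with values in `[0,∞]`. -/
def wNorm (a b : ℝ) (v : ℝ → ℝ) : ℝ≥0∞ :=
  (∫⁻ x in Ioo (0 : ℝ) 1, ENNReal.ofReal (rho a b x * v x ^ 2)) ^ (1 / 2 : ℝ)

/-- Membership in `L²_{ρ^{(a,b)}}(0,1)`. -/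
def MemWL2 (a b : ℝ) (v : ℝ → ℝ) : Prop :=
  AEStronglyMeasurable v (volume.restrict (Ioo (0 : ℝ) 1)) ∧ wNorm a b v < ⊤

/-- `w` is the weak (distributional) derivative of order `m` of `v` on `(0,1)`. -/
def IsWeakDeriv (m : ℕ) (v w : ℝ → ℝ) : Prop :=
  LocallyIntegrableOn v (Ioo (0 : ℝ) 1) ∧ LocallyIntegrableOn w (Ioo (0 : ℝ) 1) ∧
    ∀ φ : ℝ → ℝ, ContDiff ℝ ∞ φ → HasCompactSupport φ → tsupport φ ⊆ Ioo (0 : ℝ) 1 →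
      ∫ x in Ioo (0 : ℝ) 1, v x * iteratedDeriv m φ x =
        (-1) ^ m * ∫ x in Ioo (0 : ℝ) 1, w x * φ x

/-- The seminorm `|v|_{m,ρ^{(a,b)},A} = ‖D^m v‖_{ρ^{(a+m,b+m)}}`. Weak derivatives are unique up to
null sets, so the infimum is over a single value, and it is `∞` if `D^m v` does not exist. -/
def wSeminorm (m : ℕ) (a b : ℝ) (v : ℝ → ℝ) : ℝ≥0∞ :=
  ⨅ (w : ℝ → ℝ) (_ : IsWeakDeriv m v w), wNorm (a + m) (b + m) w

/-- The norm `‖v‖_{s,ρ^{(a,b)},A}` of the weighted Sobolev space `H^s_{ρ^{(a,b)},A}(0,1)`; it is `∞`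
for functions outside the space. -/
def sobolevNorm (s : ℕ) (a b : ℝ) (v : ℝ → ℝ) : ℝ≥0∞ :=
  (∑ m ∈ Finset.range (s + 1), wSeminorm m a b v ^ 2) ^ (1 / 2 : ℝ)

/-- The Jacobi polynomial `P_n^{(a,b)}` on `(-1,1)`; `Ring.choose` is the generalized binomial
coefficient `x (x - 1) ⋯ (x - m + 1) / m!`. -/
def jacobiP (n : ℕ) (a b x : ℝ) : ℝ :=
  ∑ m ∈ Finset.range (n + 1),
    1 / 2 ^ n * Ring.choose (n + a) m * Ring.choose (n + b) (n - m) *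
      (x - 1) ^ (n - m) * (x + 1) ^ m

/-- The Jacobi polynomial `G_n^{(a,b)}` shifted to `(0,1)`. -/
def jacobiG (n : ℕ) (a b t : ℝ) : ℝ := jacobiP n a b (2 * t - 1)

/-- The normalization `|||G_n^{(a,b)}|||² = ∫₀¹ (1 - t)^a t^b G_n^{(a,b)}(t)² dt`. -/
def jacobiNormSq (n : ℕ) (a b : ℝ) : ℝ :=
  ∫ t in Ioo (0 : ℝ) 1, rho a b t * jacobiG n a b t ^ 2

/-- `λ_n` for `n ≥ 0`. -/
def lam (α β : ℝ) (n : ℕ) : ℝ :=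
  Real.sin (Real.pi * α) / (Real.sin (Real.pi * (α - β)) + Real.sin (Real.pi * β)) *
    (Real.Gamma (n + α) / n.factorial)

/-- `λ_{-1}`. Since `(1 - r) / sin (π (α - β)) = 1 / (sin (π (α - β)) + sin (π β))` for `r < 1`, this
is `-(1 - r) Γ(α) sin (π α) / sin (π (α - β))`, extended continuously to `r = 1`. -/
def lamNegOne (α β : ℝ) : ℝ :=
  -(Real.Gamma α * Real.sin (Real.pi * α) /
    (Real.sin (Real.pi * (α - β)) + Real.sin (Real.pi * β)))

/-- The Jacobi moments `f_i = ∫₀¹ ρ^{(β-1,α-β-1)} f G_i^{(β-1,α-β-1)}`. -/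
def fCoeff (α β : ℝ) (f : ℝ → ℝ) (i : ℕ) : ℝ :=
  ∫ x in Ioo (0 : ℝ) 1, rho (β - 1) (α - β - 1) x * f x * jacobiG i (β - 1) (α - β - 1) x

/-- The coefficient `c_{-1}`. -/
def cNegOne (α β : ℝ) (f : ℝ → ℝ) : ℝ :=
  fCoeff α β f 0 / (lamNegOne α β * jacobiNormSq 0 (β - 1) (α - β - 1))

/-- The coefficients `c_i`, `i ≥ 0`. -/
def cCoeff (α β : ℝ) (f : ℝ → ℝ) (i : ℕ) : ℝ :=
  fCoeff α β f (i + 1) / (lam α β i * jacobiNormSq (i + 1) (β - 1) (α - β - 1))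

/-- The kernel function `k(x) = (1 - x)^{α-β-1} x^{β-1}`. -/
def kerFun (α β x : ℝ) : ℝ := (1 - x) ^ (α - β - 1) * x ^ (β - 1)

/-- The spectral approximation `q_N`. -/
def qN (α β : ℝ) (f : ℝ → ℝ) (N : ℕ) (x : ℝ) : ℝ :=
  cNegOne α β f * (x * kerFun α β x) +
    rho (α - β) β x * ∑ i ∈ Finset.range N, cCoeff α β f i * jacobiG i (α - β) β x

/-- `q` is the limit of the spectral approximations: `q - c_{-1} x k` is the limit of
`q_N - c_{-1} x k` in `L²_{ρ^{(-(α-β),-β)}}(0,1)`. This determines `q` up to null sets. -/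
def IsSpectralLimit (α β : ℝ) (f q : ℝ → ℝ) : Prop :=
  MemWL2 (-(α - β)) (-β) (fun x => q x - cNegOne α β f * (x * kerFun α β x)) ∧
    Tendsto (fun N : ℕ => wNorm (-(α - β)) (-β) (fun x =>
      (qN α β f N x - cNegOne α β f * (x * kerFun α β x)) -
        (q x - cNegOne α β f * (x * kerFun α β x)))) atTop (𝓝 0)

end

end FracSpectral

/-! Divided by `rho (α - β) β`, the error `q - q_N` is the tail `∑_{i ≥ N} c_i G_i^{(α-β,β)}`, so
both sides of the estimate can be compared coefficient by coefficient.

Derivatives of order `l` of Jacobi polynomials are again orthogonal once both weight exponents are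
raised by `l`, and their squared norms are `slEigen n l (a + b)` times the original ones
(`wInt_iterate_derivative_mul`). Hence the squared seminorm of order `l` of the tail is `∑ c_i²
slEigen i l α h_i`, with `h_i` the squared norm of `G_i^{(α-β,β)}`.

On the data side, `D^j f` is tested against `D^j G_n^{(β-1,α-β-1)}`. The adjoint operator turns this
back into an eigenvalue times the moment `f_n` (`integral_rho_mul_iterate_derivative`), and Bessel's
inequality gives `∑ slEigen n j (α-2) f_n² / H_n ≤ |f|_j²`, with `H_n` the squared norm of
`G_n^{(β-1,α-β-1)}` (`sum_slEigen_mul_sq_div_le`). Bessel suffices on this side: completeness of the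
Jacobi polynomials plays no role.

Since `c_i = f_{i+1} / (λ_i H_{i+1})`, three facts finish the termwise comparison
`cCoeff_sq_mul_le`: `h_i ≤ H_{i+1}`; `|λ_i| ≥ c i^(α-1)`, with `c` independent of `α` and `β`
(`exists_lam_lower_bound`); and a ratio of eigenvalues of order `(N(N+α-2))^(μ-j)`
(`slEigen_le_mul_slEigen`).

Two analytic points remain. The functions `ρ^{(A+j,B+j)} p` are not compactly supported test
functions, which cutoffs and dominated convergence repair (`IsWeakDeriv.integral_rho_mul`). The `L²`
limit of the differentiated partial sums must be a weak derivative of the tail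
(`isWeakDeriv_of_tendsto`). -/

namespace FracSpectral

noncomputable section

/-! ### Jacobi polynomials: lowering and raising identities, Sturm–Liouville eigenvalues -/

open Polynomial in
/-- The shifted Jacobi polynomial `G_n^{(a,b)}` as a polynomial. -/
def jacobiPoly (n : ℕ) (a b : ℝ) : ℝ[X] :=
  ∑ p ∈ Finset.HasAntidiagonal.antidiagonal n,
    C (Ring.choose (n + a) p.1 * Ring.choose (n + b) p.2) * ((X - 1) ^ p.2 * X ^ p.1)

open Polynomial in
/-- The first order operator with `(ρ^{(a+1,b+1)} q)' = ρ^{(a,b)} · weightedDeriv a b q`. -/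
def weightedDeriv (a b : ℝ) (q : ℝ[X]) : ℝ[X] :=
  (C (b + 1) * (1 - X) - C (a + 1) * X) * q + X * (1 - X) * derivative q

open Polynomial in
/-- The iterate with `D^l (ρ^{(a+l,b+l)} q) = ρ^{(a,b)} · iterWeightedDeriv l a b q`. -/
def iterWeightedDeriv : ℕ → ℝ → ℝ → ℝ[X] → ℝ[X]
  | 0, _, _, q => q
  | l + 1, a, b, q => weightedDeriv a b (iterWeightedDeriv l (a + 1) (b + 1) q)

/-- The eigenvalue `∏_{k<l} (n - k) (n + k + s + 1)` of the order `2l` Sturm–Liouville operator. -/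
def slEigen (n l : ℕ) (s : ℝ) : ℝ := ∏ k ∈ Finset.range l, ((n : ℝ) - k) * (n + k + s + 1)

theorem ring_choose_succ (x : ℝ) (k : ℕ) :
    (k + 1) * Ring.choose x (k + 1) = (x - k) * Ring.choose x k := by
  have h1 := Ring.descPochhammer_eq_factorial_smul_choose x (k + 1)
  have h2 := Ring.descPochhammer_eq_factorial_smul_choose x k
  rw [descPochhammer_succ_right, Polynomial.smeval_mul, h2] at h1
  simp only [Polynomial.smeval_sub, Polynomial.smeval_X, Polynomial.smeval_natCast, pow_one,
    pow_zero, nsmul_eq_mul, mul_one, Nat.factorial_succ, Nat.cast_mul, Nat.cast_add,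
    Nat.cast_one] at h1
  have hk : (k.factorial : ℝ) ≠ 0 := by positivity
  apply mul_left_cancel₀ hk
  linarith

theorem eval_jacobiPoly (n : ℕ) (a b t : ℝ) : (jacobiPoly n a b).eval t = jacobiG n a b t := by
  rw [jacobiPoly, jacobiG, jacobiP, Polynomial.eval_finsetSum,
    ← Finset.Nat.sum_antidiagonal_eq_sum_range_succ (fun p q => 1 / 2 ^ n *
      Ring.choose (n + a) p * Ring.choose (n + b) q * (2 * t - 1 - 1) ^ q * (2 * t - 1 + 1) ^ p)]
  refine Finset.sum_congr rfl fun p hp => ?_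
  have h : p.1 + p.2 = n := by simpa using hp
  have e1 : 2 * t - 1 - 1 = 2 * (t - 1) := by ring
  have e2 : 2 * t - 1 + 1 = 2 * t := by ring
  rw [e1, e2, mul_pow, mul_pow, ← h, pow_add]
  simp
  field_simp

theorem jacobiPoly_zero (a b : ℝ) : jacobiPoly 0 a b = 1 := by
  simp [jacobiPoly]

open Polynomial in
theorem derivative_jacobiPoly_succ (n : ℕ) (a b : ℝ) :
    derivative (jacobiPoly (n + 1) a b) =
      C (n + a + b + 2) * jacobiPoly n (a + 1) (b + 1) := by
  have key : derivative (jacobiPoly (n + 1) a b) =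
      (∑ p ∈ Finset.HasAntidiagonal.antidiagonal (n + 1), C (p.1 * (Ring.choose (n + 1 + a) p.1 *
        Ring.choose (n + 1 + b) p.2)) * ((X - 1) ^ p.2 * X ^ (p.1 - 1))) +
      ∑ p ∈ Finset.HasAntidiagonal.antidiagonal (n + 1), C (p.2 * (Ring.choose (n + 1 + a) p.1 *
        Ring.choose (n + 1 + b) p.2)) * ((X - 1) ^ (p.2 - 1) * X ^ p.1) := by
    rw [jacobiPoly, derivative_sum, ← Finset.sum_add_distrib]
    refine Finset.sum_congr rfl fun p _ => ?_
    simp only [derivative_mul, derivative_C, derivative_pow, derivative_X, derivative_sub,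
      derivative_one, map_mul, map_natCast, Nat.cast_add, Nat.cast_one]
    ring
  -- The dropped boundary terms `p.1 = 0` and `p.2 = 0` carry a zero factor. After reindexing, both
  -- sums run over the same monomials of degree `n`.
  rw [key, Finset.Nat.sum_antidiagonal_succ, Finset.Nat.sum_antidiagonal_succ', jacobiPoly,
    Finset.mul_sum]
  simp only [Nat.cast_zero, zero_mul, map_zero, zero_add, add_tsub_cancel_right]
  rw [← Finset.sum_add_distrib]
  refine Finset.sum_congr rfl fun p hp => ?_
  have h : (p.1 : ℝ) + p.2 = n := by exact_mod_cast (Finset.HasAntidiagonal.mem_antidiagonal.1 hp)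
  generalize (X - 1 : ℝ[X]) ^ p.2 * X ^ p.1 = M
  rw [← mul_assoc (C (n + a + b + 2 : ℝ)), ← add_mul, ← C_add, ← C_mul]
  congr 2
  have h1 := ring_choose_succ (n + 1 + a) p.1
  have h2 := ring_choose_succ (n + 1 + b) p.2
  have e1 : (n : ℝ) + (a + 1) = n + 1 + a := by ring
  have e2 : (n : ℝ) + (b + 1) = n + 1 + b := by ring
  rw [e1, e2]
  push_cast
  linear_combination Ring.choose (n + 1 + b) p.2 * h1 + Ring.choose (n + 1 + a) p.1 * h2
    - Ring.choose (n + 1 + a) p.1 * Ring.choose (n + 1 + b) p.2 * h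

open Polynomial in
theorem weightedDeriv_sum {ι : Type*} (s : Finset ι) (a b : ℝ) (f : ι → ℝ[X]) :
    weightedDeriv a b (∑ i ∈ s, f i) = ∑ i ∈ s, weightedDeriv a b (f i) := by
  simp only [weightedDeriv, derivative_sum, Finset.mul_sum, Finset.sum_add_distrib]

open Polynomial in
theorem weightedDeriv_C_mul (a b c : ℝ) (q : ℝ[X]) :
    weightedDeriv a b (C c * q) = C c * weightedDeriv a b q := by
  simp only [weightedDeriv, derivative_mul, derivative_C]
  ring

open Polynomial in
theorem weightedDeriv_pow_mul_pow (a b : ℝ) (p q : ℕ) :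
    weightedDeriv a b ((X - 1) ^ q * X ^ p) =
      -(C (b + 1 + p) * ((X - 1) ^ (q + 1) * X ^ p) +
        C (a + 1 + q) * ((X - 1) ^ q * X ^ (p + 1))) := by
  -- Zero exponents are separated because `derivative_pow` produces truncated `p - 1` and `q - 1`.
  rcases p with _ | p <;> rcases q with _ | q <;>
    simp [weightedDeriv, derivative_pow] <;> ring

-- One step of Rodrigues' formula: the raising operator is dual to the derivative. Writing `n + 1 =
-- p.1 + p.2` splits the right side into the two families of monomials that the operator produces.
open Polynomial in
theorem weightedDeriv_jacobiPoly (n : ℕ) (a b : ℝ) :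
    weightedDeriv a b (jacobiPoly n (a + 1) (b + 1)) =
      C (-(n + 1 : ℝ)) * jacobiPoly (n + 1) a b := by
  have key : C (-(n + 1 : ℝ)) * jacobiPoly (n + 1) a b =
      (∑ p ∈ Finset.HasAntidiagonal.antidiagonal (n + 1), C (-(p.1 * (Ring.choose (n + 1 + a) p.1 *
        Ring.choose (n + 1 + b) p.2))) * ((X - 1) ^ p.2 * X ^ p.1)) +
      ∑ p ∈ Finset.HasAntidiagonal.antidiagonal (n + 1), C (-(p.2 * (Ring.choose (n + 1 + a) p.1 *
        Ring.choose (n + 1 + b) p.2))) * ((X - 1) ^ p.2 * X ^ p.1) := by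
    rw [jacobiPoly, Finset.mul_sum, ← Finset.sum_add_distrib]
    refine Finset.sum_congr rfl fun p hp => ?_
    have h : (p.1 : ℝ) + p.2 = n + 1 := by
      exact_mod_cast (Finset.HasAntidiagonal.mem_antidiagonal.1 hp)
    rw [← mul_assoc, ← C_mul, ← add_mul, ← C_add]
    congr 2
    push_cast
    rw [← h]
    ring
  rw [key, Finset.Nat.sum_antidiagonal_succ, Finset.Nat.sum_antidiagonal_succ', jacobiPoly,
    weightedDeriv_sum]
  simp only [Nat.cast_zero, zero_mul, neg_zero, map_zero, zero_add, weightedDeriv_C_mul,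
    weightedDeriv_pow_mul_pow]
  rw [← Finset.sum_add_distrib]
  refine Finset.sum_congr rfl fun p hp => ?_
  have h : (p.1 : ℝ) + p.2 = n := by exact_mod_cast (Finset.HasAntidiagonal.mem_antidiagonal.1 hp)
  have h1 := ring_choose_succ (n + 1 + a) p.1
  have h2 := ring_choose_succ (n + 1 + b) p.2
  have e1 : (n : ℝ) + (a + 1) = n + 1 + a := by ring
  have e2 : (n : ℝ) + (b + 1) = n + 1 + b := by ring
  rw [e1, e2]
  generalize (X - 1 : ℝ[X]) ^ (p.2 + 1) * X ^ p.1 = M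
  generalize (X - 1 : ℝ[X]) ^ p.2 * X ^ (p.1 + 1) = M'
  rw [neg_add, mul_add, mul_neg, mul_neg, ← mul_assoc, ← mul_assoc, ← C_mul, ← C_mul, ← neg_mul,
    ← neg_mul, ← C_neg, ← C_neg, add_comm]
  congr 3
  · push_cast
    linear_combination Ring.choose (n + 1 + b) p.2 * h1
      - Ring.choose (n + 1 + a) p.1 * Ring.choose (n + 1 + b) p.2 * h
  · push_cast
    linear_combination Ring.choose (n + 1 + a) p.1 * h2
      - Ring.choose (n + 1 + a) p.1 * Ring.choose (n + 1 + b) p.2 * h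

theorem jacobiG_reflect (n : ℕ) (a b t : ℝ) :
    jacobiG n a b (1 - t) = (-1) ^ n * jacobiG n b a t := by
  rw [← eval_jacobiPoly, ← eval_jacobiPoly, jacobiPoly, jacobiPoly, Polynomial.eval_finsetSum,
    Polynomial.eval_finsetSum, ← Finset.Nat.sum_antidiagonal_swap, Finset.mul_sum]
  refine Finset.sum_congr rfl fun p hp => ?_
  have h : p.1 + p.2 = n := by simpa using hp
  have e : ((-1 : ℝ)) ^ n = (-1) ^ p.1 * (-1) ^ p.2 := by rw [← pow_add, h]
  have e1 : (1 : ℝ) - t - 1 = (-1) * t := by ring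
  have e2 : (1 : ℝ) - t = (-1) * (t - 1) := by ring
  simp only [Prod.fst_swap, Prod.snd_swap, Polynomial.eval_mul, Polynomial.eval_C,
    Polynomial.eval_pow, Polynomial.eval_sub, Polynomial.eval_X, Polynomial.eval_one]
  rw [e, e1, e2, mul_pow, mul_pow]
  ring

theorem slEigen_zero_right (n : ℕ) (s : ℝ) : slEigen n 0 s = 1 := by simp [slEigen]

theorem slEigen_zero_left (l : ℕ) (s : ℝ) : slEigen 0 (l + 1) s = 0 := by
  simp [slEigen, Finset.prod_range_succ']

theorem slEigen_succ_succ (n l : ℕ) (s : ℝ) :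
    slEigen (n + 1) (l + 1) s = (n + 1) * (n + s + 2) * slEigen n l (s + 2) := by
  rw [slEigen, Finset.prod_range_succ', slEigen, mul_comm]
  congr 1
  · push_cast; ring
  · refine Finset.prod_congr rfl fun k _ => ?_
    push_cast; ring

open Polynomial in
theorem iterWeightedDeriv_C_mul (l : ℕ) (a b c : ℝ) (q : ℝ[X]) :
    iterWeightedDeriv l a b (C c * q) = C c * iterWeightedDeriv l a b q := by
  induction l generalizing a b with
  | zero => rfl
  | succ l ih => rw [iterWeightedDeriv, ih, weightedDeriv_C_mul, iterWeightedDeriv]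

open Polynomial in
theorem iterWeightedDeriv_zero (l : ℕ) (a b : ℝ) : iterWeightedDeriv l a b 0 = 0 := by
  simpa using iterWeightedDeriv_C_mul l a b 0 0

-- The derivatives lower the degree while raising the parameters, and the weighted derivatives climb
-- back. Each matched pair contributes one eigenvalue factor and one sign.
open Polynomial in
theorem iterWeightedDeriv_derivative_jacobiPoly (l n : ℕ) (a b : ℝ) :
    iterWeightedDeriv l a b (derivative^[l] (jacobiPoly n a b)) =
      C ((-1) ^ l * slEigen n l (a + b)) * jacobiPoly n a b := by
  induction l generalizing n a b with
  | zero => simp [iterWeightedDeriv, slEigen_zero_right]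
  | succ l ih =>
    rcases n with _ | n
    · rw [slEigen_zero_left, jacobiPoly_zero, Function.iterate_succ_apply, derivative_one,
        iterate_derivative_zero, iterWeightedDeriv_zero]
      simp
    · rw [Function.iterate_succ_apply, derivative_jacobiPoly_succ, iterate_derivative_C_mul,
        iterWeightedDeriv_C_mul, iterWeightedDeriv, ih, weightedDeriv_C_mul,
        weightedDeriv_jacobiPoly, slEigen_succ_succ, ← mul_assoc, ← mul_assoc, ← C_mul, ← C_mul]
      congr 2
      rw [show a + 1 + (b + 1) = a + b + 2 by ring]
      ring

/-! ### The weights and the measures `nu a b` -/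

theorem rho_pos (a b : ℝ) {x : ℝ} (hx : x ∈ Ioo (0 : ℝ) 1) : 0 < rho a b x :=
  mul_pos (Real.rpow_pos_of_pos (by linarith [hx.2]) _) (Real.rpow_pos_of_pos hx.1 _)

theorem measurable_rho (a b : ℝ) : Measurable (rho a b) := by
  unfold rho; fun_prop

theorem rho_add (a b c d : ℝ) {x : ℝ} (hx : x ∈ Ioo (0 : ℝ) 1) :
    rho (a + c) (b + d) x = rho a b x * rho c d x := by
  have h1 : 0 < 1 - x := by linarith [hx.2]
  simp only [rho]
  rw [Real.rpow_add h1, Real.rpow_add hx.1]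
  ring

theorem rho_natCast (n : ℕ) (x : ℝ) : rho n n x = (x * (1 - x)) ^ n := by
  simp only [rho, Real.rpow_natCast, mul_pow]
  ring

theorem contDiffAt_rho (a b : ℝ) {x : ℝ} (hx : x ∈ Ioo (0 : ℝ) 1) {n : WithTop ℕ∞} :
    ContDiffAt ℝ n (rho a b) x := by
  have h1 : 1 - x ≠ 0 := by linarith [hx.2]
  unfold rho
  exact ((contDiffAt_const.sub contDiffAt_id).rpow_const_of_ne h1).mul
    (contDiffAt_id.rpow_const_of_ne hx.1.ne')

theorem integrableOn_rho {a b : ℝ} (ha : -1 < a) (hb : -1 < b) :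
    IntegrableOn (rho a b) (Ioo 0 1) := by
  -- The Beta integrand is `x^(u-1) (1-x)^(v-1)`, hence `u = b + 1` and `v = a + 1`.
  have h := Complex.betaIntegral_convergent (u := ((b + 1 : ℝ) : ℂ)) (v := ((a + 1 : ℝ) : ℂ))
    (by simpa using by linarith) (by simpa using by linarith)
  rw [intervalIntegrable_iff_integrableOn_Ioo_of_le zero_le_one] at h
  refine IntegrableOn.congr_fun h.norm (fun x hx => ?_) measurableSet_Ioo
  have h1 : 0 < 1 - x := by linarith [hx.2]
  have e2 : (1 : ℂ) - x = ((1 - x : ℝ) : ℂ) := by push_cast; ring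
  rw [e2, norm_mul, Complex.norm_cpow_eq_rpow_re_of_pos hx.1,
    Complex.norm_cpow_eq_rpow_re_of_pos h1]
  simp [rho, mul_comm]

/-- The measure `ρ^{(a,b)} dx` on `(0,1)`. -/
def nu (a b : ℝ) : Measure ℝ :=
  (volume.restrict (Ioo (0 : ℝ) 1)).withDensity fun x => ENNReal.ofReal (rho a b x)

theorem isFiniteMeasure_nu {a b : ℝ} (ha : -1 < a) (hb : -1 < b) : IsFiniteMeasure (nu a b) :=
  isFiniteMeasure_withDensity_ofReal (integrableOn_rho ha hb).2

theorem nu_absolutelyContinuous (a b : ℝ) : nu a b ≪ volume.restrict (Ioo (0 : ℝ) 1) :=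
  withDensity_absolutelyContinuous _ _

theorem absolutelyContinuous_nu (a b : ℝ) : volume.restrict (Ioo (0 : ℝ) 1) ≪ nu a b := by
  refine withDensity_absolutelyContinuous' (measurable_rho a b).ennreal_ofReal.aemeasurable ?_
  filter_upwards [ae_restrict_mem measurableSet_Ioo] with x hx
  simpa using rho_pos a b hx

theorem integral_nu (a b : ℝ) (g : ℝ → ℝ) :
    ∫ x, g x ∂nu a b = ∫ x in Ioo (0 : ℝ) 1, rho a b x * g x := by
  rw [nu, integral_withDensity_eq_integral_toReal_smul (measurable_rho a b).ennreal_ofReal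
    (ae_of_all _ fun _ => ENNReal.ofReal_lt_top)]
  refine setIntegral_congr_fun measurableSet_Ioo fun x hx => ?_
  simp [ENNReal.toReal_ofReal (rho_pos a b hx).le]

theorem integrable_nu_iff (a b : ℝ) (g : ℝ → ℝ) :
    Integrable g (nu a b) ↔ IntegrableOn (fun x => rho a b x * g x) (Ioo 0 1) := by
  rw [nu, integrable_withDensity_iff_integrable_smul' (measurable_rho a b).ennreal_ofReal
    (ae_of_all _ fun _ => ENNReal.ofReal_lt_top)]
  refine integrableOn_congr_fun (fun x hx => ?_) measurableSet_Ioo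
  simp [ENNReal.toReal_ofReal (rho_pos a b hx).le]

theorem wNorm_eq_eLpNorm (a b : ℝ) (v : ℝ → ℝ) : wNorm a b v = eLpNorm v 2 (nu a b) := by
  rw [wNorm, eLpNorm_eq_lintegral_rpow_enorm_toReal (by simp) (by simp), nu,
    lintegral_withDensity_eq_lintegral_mul_non_measurable _ (measurable_rho a b).ennreal_ofReal
      (ae_of_all _ fun _ => ENNReal.ofReal_lt_top)]
  congr 1
  refine setLIntegral_congr_fun measurableSet_Ioo fun x hx => ?_
  simp only [Pi.mul_apply, ENNReal.toReal_ofNat, ENNReal.rpow_ofNat]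
  rw [ENNReal.ofReal_mul (rho_pos a b hx).le, ← sq_abs, ENNReal.ofReal_pow (abs_nonneg _),
    ← Real.enorm_eq_ofReal_abs]

theorem memWL2_iff (a b : ℝ) (v : ℝ → ℝ) : MemWL2 a b v ↔ MemLp v 2 (nu a b) := by
  rw [MemWL2, MemLp, wNorm_eq_eLpNorm]
  exact and_congr_left fun _ =>
    ⟨fun h => h.mono_ac (nu_absolutelyContinuous a b),
      fun h => h.mono_ac (absolutelyContinuous_nu a b)⟩

theorem memLp_eval {a b : ℝ} (ha : -1 < a) (hb : -1 < b) (p : Polynomial ℝ) :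
    MemLp (fun x => p.eval x) 2 (nu a b) := by
  have := isFiniteMeasure_nu ha hb
  obtain ⟨C, hC⟩ := isCompact_Icc.exists_bound_of_continuousOn (s := Icc (0 : ℝ) 1)
    (f := fun x => p.eval x) p.continuous.continuousOn
  refine MemLp.of_bound p.continuous.aestronglyMeasurable C ?_
  refine (nu_absolutelyContinuous a b).ae_le ?_
  filter_upwards [ae_restrict_mem measurableSet_Ioo] with x hx
  exact hC x (Ioo_subset_Icc_self hx)

theorem hasDerivAt_rho_mul_eval (a b : ℝ) (q : Polynomial ℝ) {x : ℝ} (hx : x ∈ Ioo (0 : ℝ) 1) :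
    HasDerivAt (fun y => rho (a + 1) (b + 1) y * q.eval y)
      (rho a b x * (weightedDeriv a b q).eval x) x := by
  have h1 : 0 < 1 - x := by linarith [hx.2]
  have d1 : HasDerivAt (fun y : ℝ => (1 - y) ^ (a + 1)) (-1 * (a + 1) * (1 - x) ^ (a + 1 - 1)) x :=
    ((hasDerivAt_id x).const_sub 1).rpow_const (Or.inl h1.ne')
  have d2 : HasDerivAt (fun y : ℝ => y ^ (b + 1)) ((b + 1) * x ^ (b + 1 - 1)) x := by
    simpa using (hasDerivAt_id x).rpow_const (p := b + 1) (Or.inl hx.1.ne')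
  refine ((d1.mul d2).mul (q.hasDerivAt x)).congr_deriv ?_
  simp only [rho, weightedDeriv, add_sub_cancel_right, Pi.mul_apply, Polynomial.eval_add,
    Polynomial.eval_mul, Polynomial.eval_sub, Polynomial.eval_C, Polynomial.eval_X, Polynomial.eval_one]
  rw [Real.rpow_add h1, Real.rpow_add hx.1, Real.rpow_one, Real.rpow_one]
  ring

/-! ### Weighted integration by parts, orthogonality and norms -/

/-- The weighted integral of a polynomial. -/
def wInt (a b : ℝ) (p : Polynomial ℝ) : ℝ := ∫ x in Ioo (0 : ℝ) 1, rho a b x * p.eval x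

theorem integrableOn_rho_mul_eval {a b : ℝ} (ha : -1 < a) (hb : -1 < b) (p : Polynomial ℝ) :
    IntegrableOn (fun x => rho a b x * p.eval x) (Ioo 0 1) := by
  have := isFiniteMeasure_nu ha hb
  rw [← integrable_nu_iff]
  exact (memLp_eval ha hb p).integrable (by norm_num)

theorem wInt_C_mul (a b c : ℝ) (p : Polynomial ℝ) :
    wInt a b (Polynomial.C c * p) = c * wInt a b p := by
  rw [wInt, wInt, ← integral_const_mul]
  congr 1; ext x
  simp; ring

theorem wInt_add {a b : ℝ} (ha : -1 < a) (hb : -1 < b) (p q : Polynomial ℝ) :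
    wInt a b (p + q) = wInt a b p + wInt a b q := by
  rw [wInt, wInt, wInt, ← integral_add (integrableOn_rho_mul_eval ha hb p)
    (integrableOn_rho_mul_eval ha hb q)]
  congr 1; ext x
  simp; ring

/-- The integrand is the derivative of `ρ^{(a+1,b+1)} q`, which vanishes at both endpoints because
`a + 1` and `b + 1` are positive. -/
theorem wInt_weightedDeriv {a b : ℝ} (ha : -1 < a) (hb : -1 < b) (q : Polynomial ℝ) :
    wInt a b (weightedDeriv a b q) = 0 := by
  have hc : ContinuousOn (fun y => rho (a + 1) (b + 1) y * q.eval y) (Icc 0 1) := by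
    unfold rho
    refine (ContinuousOn.mul ?_ ?_).mul q.continuous.continuousOn
    · exact (continuous_const.sub continuous_id).continuousOn.rpow_const
        fun _ _ => Or.inr (by linarith)
    · exact continuousOn_id.rpow_const fun _ _ => Or.inr (by linarith)
  have hi : IntervalIntegrable (fun x => rho a b x * (weightedDeriv a b q).eval x) volume 0 1 := by
    rw [intervalIntegrable_iff_integrableOn_Ioo_of_le zero_le_one]
    exact integrableOn_rho_mul_eval ha hb _
  have h := intervalIntegral.integral_eq_sub_of_hasDerivAt_of_le zero_le_one hc
    (fun x hx => hasDerivAt_rho_mul_eval a b q hx) hi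
  rw [intervalIntegral.integral_of_le zero_le_one, integral_Ioc_eq_integral_Ioo] at h
  rw [wInt, h]
  have e1 : a + 1 ≠ 0 := by linarith
  have e2 : b + 1 ≠ 0 := by linarith
  simp [rho, Real.zero_rpow e1, Real.zero_rpow e2]

theorem wInt_add_one (a b : ℝ) (p : Polynomial ℝ) :
    wInt (a + 1) (b + 1) p = wInt a b (Polynomial.X * (1 - Polynomial.X) * p) := by
  refine setIntegral_congr_fun measurableSet_Ioo fun x hx => ?_
  have := rho_add a b 1 1 hx
  simp only [this, Polynomial.eval_mul, Polynomial.eval_sub, Polynomial.eval_X,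
    Polynomial.eval_one]
  simp only [rho, Real.rpow_one]
  ring

theorem wInt_weightedDeriv_mul {a b : ℝ} (ha : -1 < a) (hb : -1 < b) (q p : Polynomial ℝ) :
    wInt a b (weightedDeriv a b q * p) =
      -wInt (a + 1) (b + 1) (q * Polynomial.derivative p) := by
  have h := wInt_weightedDeriv ha hb (q * p)
  have e : weightedDeriv a b (q * p) = weightedDeriv a b q * p +
      Polynomial.X * (1 - Polynomial.X) * (q * Polynomial.derivative p) := by
    simp only [weightedDeriv, Polynomial.derivative_mul]
    ring
  rw [e, wInt_add ha hb, ← wInt_add_one] at h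
  linarith

theorem wInt_jacobiPoly_succ_mul {a b : ℝ} (ha : -1 < a) (hb : -1 < b) (n : ℕ)
    (p : Polynomial ℝ) :
    (n + 1) * wInt a b (jacobiPoly (n + 1) a b * p) =
      wInt (a + 1) (b + 1) (jacobiPoly n (a + 1) (b + 1) * Polynomial.derivative p) := by
  have h := wInt_weightedDeriv_mul ha hb (jacobiPoly n (a + 1) (b + 1)) p
  rw [weightedDeriv_jacobiPoly, mul_assoc, wInt_C_mul] at h
  linarith

theorem iterate_derivative_jacobiPoly_of_lt {m n : ℕ} (h : m < n) (a b : ℝ) :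
    Polynomial.derivative^[n] (jacobiPoly m a b) = 0 := by
  induction n generalizing m a b with
  | zero => omega
  | succ n ih =>
    rcases m with _ | m
    · rw [jacobiPoly_zero, Function.iterate_succ_apply, Polynomial.derivative_one,
        Polynomial.iterate_derivative_zero]
    · rw [Function.iterate_succ_apply, derivative_jacobiPoly_succ,
        Polynomial.iterate_derivative_C_mul, ih (by omega), mul_zero]

/-- Orthogonality to lower degrees, phrased through `derivative^[n] p = 0` so that each integration
by parts consumes one derivative. -/
theorem wInt_jacobiPoly_mul_eq_zero {a b : ℝ} (ha : -1 < a) (hb : -1 < b) (n : ℕ)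
    (p : Polynomial ℝ) (hp : Polynomial.derivative^[n] p = 0) :
    wInt a b (jacobiPoly n a b * p) = 0 := by
  induction n generalizing a b p with
  | zero => simp_all [wInt]
  | succ n ih =>
    have h := wInt_jacobiPoly_succ_mul ha hb n p
    rw [ih (by linarith) (by linarith) _ (by rwa [← Function.iterate_succ_apply])] at h
    exact (mul_eq_zero.1 h).resolve_left (by positivity)

theorem wInt_jacobiPoly_mul_of_ne {a b : ℝ} (ha : -1 < a) (hb : -1 < b) {m n : ℕ} (h : m ≠ n) :
    wInt a b (jacobiPoly m a b * jacobiPoly n a b) = 0 := by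
  rcases lt_or_gt_of_ne h with h | h
  · rw [mul_comm]
    exact wInt_jacobiPoly_mul_eq_zero ha hb n _ (iterate_derivative_jacobiPoly_of_lt h a b)
  · exact wInt_jacobiPoly_mul_eq_zero ha hb m _ (iterate_derivative_jacobiPoly_of_lt h a b)

theorem wInt_iterate_derivative_mul {a b : ℝ} (ha : -1 < a) (hb : -1 < b) (n l : ℕ)
    (p : Polynomial ℝ) :
    wInt (a + l) (b + l)
      (Polynomial.derivative^[l] (jacobiPoly n a b) * Polynomial.derivative^[l] p) =
      slEigen n l (a + b) * wInt a b (jacobiPoly n a b * p) := by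
  induction l generalizing n a b p with
  | zero => simp [slEigen_zero_right]
  | succ l ih =>
    rcases n with _ | n
    · rw [slEigen_zero_left, iterate_derivative_jacobiPoly_of_lt (Nat.succ_pos l), zero_mul,
        zero_mul]
      simp [wInt]
    · have e1 : a + ((l + 1 : ℕ) : ℝ) = a + 1 + l := by push_cast; ring
      have e2 : b + ((l + 1 : ℕ) : ℝ) = b + 1 + l := by push_cast; ring
      rw [Function.iterate_succ_apply, Function.iterate_succ_apply, derivative_jacobiPoly_succ,
        Polynomial.iterate_derivative_C_mul, mul_assoc, wInt_C_mul, e1, e2,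
        ih (by linarith) (by linarith), ← wInt_jacobiPoly_succ_mul ha hb, slEigen_succ_succ,
        show a + 1 + (b + 1) = a + b + 2 by ring]
      ring

theorem jacobiNormSq_eq_wInt (n : ℕ) (a b : ℝ) :
    jacobiNormSq n a b = wInt a b (jacobiPoly n a b * jacobiPoly n a b) := by
  rw [jacobiNormSq, wInt]
  congr 1; ext x
  rw [Polynomial.eval_mul, eval_jacobiPoly, sq]

theorem jacobiNormSq_succ {a b : ℝ} (ha : -1 < a) (hb : -1 < b) (n : ℕ) :
    (n + 1) * jacobiNormSq (n + 1) a b = (n + a + b + 2) * jacobiNormSq n (a + 1) (b + 1) := by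
  rw [jacobiNormSq_eq_wInt, wInt_jacobiPoly_succ_mul ha hb, derivative_jacobiPoly_succ,
    mul_left_comm, wInt_C_mul, jacobiNormSq_eq_wInt]

/-- The recursion in `n` reduces to the integral of a weight, so `G_n ≠ 0` need not be shown
directly. -/
theorem jacobiNormSq_pos {a b : ℝ} (ha : -1 < a) (hb : -1 < b) (n : ℕ) :
    0 < jacobiNormSq n a b := by
  induction n generalizing a b with
  | zero =>
    rw [jacobiNormSq_eq_wInt, jacobiPoly_zero, wInt]
    simp only [mul_one, Polynomial.eval_one]
    rw [setIntegral_pos_iff_support_of_nonneg_ae]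
    · have : Ioo (0 : ℝ) 1 ⊆ Function.support (rho a b) := fun x hx => (rho_pos a b hx).ne'
      rw [inter_eq_right.2 this]
      simp
    · filter_upwards [ae_restrict_mem measurableSet_Ioo] with x hx using (rho_pos a b hx).le
    · exact integrableOn_rho ha hb
  | succ n ih =>
    have h := jacobiNormSq_succ ha hb n
    have h1 := ih (a := a + 1) (b := b + 1) (by linarith) (by linarith)
    have h2 : 0 < (n + a + b + 2) * jacobiNormSq n (a + 1) (b + 1) :=
      mul_pos (by linarith [(Nat.cast_nonneg n : (0 : ℝ) ≤ n)]) h1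
    rw [← h] at h2
    exact (mul_pos_iff_of_pos_left (by positivity)).1 h2

/-- Reflection `t ↦ 1 - t`. It is needed because raising the data parameters `(β-1, α-β-1)` gives
`(β, α-β)`, the solution parameters in reverse order. -/
theorem jacobiNormSq_comm (n : ℕ) (a b : ℝ) : jacobiNormSq n a b = jacobiNormSq n b a := by
  simp only [jacobiNormSq, ← integral_Ioc_eq_integral_Ioo,
    ← intervalIntegral.integral_of_le (zero_le_one (α := ℝ))]
  have h := intervalIntegral.integral_comp_sub_left (a := 0) (b := 1)
    (fun x => rho a b x * jacobiG n a b x ^ 2) 1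
  simp only [sub_self, sub_zero] at h
  rw [← h]
  congr 1; ext x
  rw [jacobiG_reflect, mul_pow, ← pow_mul, mul_comm n 2, pow_mul]
  simp only [rho, sub_sub_cancel]
  ring

/-! ### Cutoffs and testing a weak derivative against weighted polynomials -/

/-- Families of functions on `(0,1)` whose `k`-th derivatives are `O(W · (x(1-x))^{-k})`,
uniformly along the family. -/
def ScaledBound (W : ℝ → ℝ) (u : ℕ → ℝ → ℝ) : Prop :=
  ∀ k : ℕ, ∃ C : ℝ, ∀ m : ℕ, ∀ x ∈ Ioo (0 : ℝ) 1,
    (x * (1 - x)) ^ k * |iteratedDeriv k (u m) x| ≤ C * W x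

theorem ScaledBound.mul {W W' : ℝ → ℝ} {u v : ℕ → ℝ → ℝ} (hu : ScaledBound W u)
    (hv : ScaledBound W' v) (hu' : ∀ m, ∀ x ∈ Ioo (0 : ℝ) 1, ContDiffAt ℝ ∞ (u m) x)
    (hv' : ∀ m, ∀ x ∈ Ioo (0 : ℝ) 1, ContDiffAt ℝ ∞ (v m) x) :
    ScaledBound (fun x => W x * W' x) fun m x => u m x * v m x := by
  choose C hC using hu
  choose C' hC' using hv
  intro k
  refine ⟨∑ i ∈ Finset.range (k + 1), k.choose i * C i * C' (k - i), fun m x hx => ?_⟩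
  have hd : 0 ≤ x * (1 - x) := mul_nonneg hx.1.le (by linarith [hx.2])
  rw [iteratedDeriv_fun_mul ((hu' m x hx).of_le (mod_cast le_top))
    ((hv' m x hx).of_le (mod_cast le_top)), Finset.sum_mul]
  refine (mul_le_mul_of_nonneg_left (Finset.abs_sum_le_sum_abs _ _) (by positivity)).trans ?_
  rw [Finset.mul_sum]
  refine Finset.sum_le_sum fun i hi => ?_
  have hik : i + (k - i) = k := by have := Finset.mem_range.1 hi; omega
  have h1 := hC i m x hx
  have h2 := hC' (k - i) m x hx
  have h3 := mul_le_mul h1 h2 (by positivity) (le_trans (by positivity) h1)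
  calc (x * (1 - x)) ^ k * |k.choose i * iteratedDeriv i (u m) x * iteratedDeriv (k - i) (v m) x|
      = k.choose i * ((x * (1 - x)) ^ i * |iteratedDeriv i (u m) x| *
          ((x * (1 - x)) ^ (k - i) * |iteratedDeriv (k - i) (v m) x|)) := by
        nth_rw 1 [← hik]
        rw [pow_add, abs_mul, abs_mul, Nat.abs_cast]
        ring
    _ ≤ k.choose i * (C i * W x * (C' (k - i) * W' x)) := by gcongr
    _ = _ := by ring

/-- A smooth step vanishing on `(-∞, 1]` and equal to `1` on `[2, ∞)`. -/
def smoothStep (t : ℝ) : ℝ := Real.smoothTransition (t - 1)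

theorem contDiff_smoothStep : ContDiff ℝ ∞ smoothStep :=
  Real.smoothTransition.contDiff.comp (contDiff_id.sub contDiff_const)

theorem smoothStep_of_le {t : ℝ} (h : t ≤ 1) : smoothStep t = 0 :=
  Real.smoothTransition.zero_of_nonpos (by linarith)

theorem smoothStep_of_ge {t : ℝ} (h : 2 ≤ t) : smoothStep t = 1 :=
  Real.smoothTransition.one_of_one_le (by linarith)

/-- Compactness handles `[0, 3]`. Beyond it the step is constant, and the bound `1` is needed there
only for `k = 0`. -/
theorem exists_pow_mul_iteratedDeriv_smoothStep_le (k : ℕ) :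
    ∃ C : ℝ, ∀ t : ℝ, 0 ≤ t → t ^ k * |iteratedDeriv k smoothStep t| ≤ C := by
  have hc : Continuous fun t : ℝ => t ^ k * |iteratedDeriv k smoothStep t| :=
    (continuous_pow k).mul (contDiff_smoothStep.continuous_iteratedDeriv k (mod_cast le_top)).abs
  obtain ⟨C, hC⟩ := (isCompact_Icc (a := (0 : ℝ)) (b := 3)).bddAbove_image hc.continuousOn
  refine ⟨max C 1, fun t ht => ?_⟩
  rcases le_or_gt t 3 with h | h
  · exact (hC ⟨t, ⟨ht, h⟩, rfl⟩).trans (le_max_left _ _)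
  · have he : smoothStep =ᶠ[𝓝 t] fun _ => 1 := by
      filter_upwards [lt_mem_nhds h] with s hs using smoothStep_of_ge (by linarith)
    rw [he.iteratedDeriv_eq, iteratedDeriv_const]
    refine le_trans ?_ (le_max_right _ _)
    split_ifs with hk
    · simp [hk]
    · simp

/-- A smooth cutoff supported in `[1/(m+1), 1 - 1/(m+1)]`. -/
def cutoff (m : ℕ) (x : ℝ) : ℝ := smoothStep ((m + 1) * x) * smoothStep ((m + 1) * (1 - x))

/-- Scale invariance: with `t = (m + 1) x`, `x^k` times the `k`-th derivative of the dilated step is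
`t^k` times that of the step at `t`, so the bound does not depend on `m`. The product `1 * 1`
matches the output of `ScaledBound.mul`. -/
theorem scaledBound_cutoff : ScaledBound (fun _ => 1 * 1) cutoff := by
  have hs : ∀ c : ℝ, ContDiff ℝ ∞ fun x => smoothStep (c * x) := fun c =>
    contDiff_smoothStep.comp (contDiff_const.mul contDiff_id)
  refine ScaledBound.mul (W := fun _ => 1) (W' := fun _ => 1)
    (u := fun m x => smoothStep ((m + 1) * x)) (v := fun m x => smoothStep ((m + 1) * (1 - x)))
    (fun k => ?_) (fun k => ?_)
    (fun m x _ => (hs _).contDiffAt) fun m x _ =>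
      ((hs _).comp (contDiff_const.sub contDiff_id)).contDiffAt
  · obtain ⟨C, hC⟩ := exists_pow_mul_iteratedDeriv_smoothStep_le k
    refine ⟨C, fun m x hx => ?_⟩
    have h1 : 0 < 1 - x := by linarith [hx.2]
    rw [iteratedDeriv_comp_const_mul (contDiff_smoothStep.of_le (mod_cast le_top)), abs_mul, abs_pow,
      abs_of_pos (by positivity : (0 : ℝ) < m + 1), mul_one]
    refine le_trans ?_ (hC ((m + 1) * x) (by have := hx.1; positivity))
    rw [← mul_assoc, ← mul_pow]
    refine mul_le_mul_of_nonneg_right (pow_le_pow_left₀ ?_ ?_ k) (abs_nonneg _)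
    · have := hx.1; positivity
    · nlinarith [mul_pos hx.1 hx.1,
        mul_nonneg (Nat.cast_nonneg m : (0 : ℝ) ≤ m) (mul_pos hx.1 hx.1).le]
  · obtain ⟨C, hC⟩ := exists_pow_mul_iteratedDeriv_smoothStep_le k
    refine ⟨C, fun m x hx => ?_⟩
    have h1 : 0 < 1 - x := by linarith [hx.2]
    rw [iteratedDeriv_comp_const_sub k (fun y => smoothStep ((m + 1) * y)) 1,
      iteratedDeriv_comp_const_mul (contDiff_smoothStep.of_le (mod_cast le_top))]
    simp only [smul_eq_mul]
    rw [abs_mul, abs_pow, abs_neg, abs_one, one_pow, one_mul, abs_mul, abs_pow,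
      abs_of_pos (by positivity : (0 : ℝ) < m + 1), mul_one]
    refine le_trans ?_ (hC ((m + 1) * (1 - x)) (by positivity))
    rw [← mul_assoc, ← mul_pow]
    refine mul_le_mul_of_nonneg_right (pow_le_pow_left₀ ?_ ?_ k) (abs_nonneg _)
    · have := hx.1; positivity
    · nlinarith [mul_pos h1 h1, mul_nonneg (Nat.cast_nonneg m : (0 : ℝ) ≤ m) (mul_pos h1 h1).le]

theorem contDiff_cutoff (m : ℕ) : ContDiff ℝ ∞ (cutoff m) :=
  (contDiff_smoothStep.comp (contDiff_const.mul contDiff_id)).mul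
    (contDiff_smoothStep.comp (contDiff_const.mul (contDiff_const.sub contDiff_id)))

theorem support_cutoff_subset (m : ℕ) :
    Function.support (cutoff m) ⊆ Icc (1 / (m + 1 : ℝ)) (1 - 1 / (m + 1 : ℝ)) := by
  intro x hx
  have hm : (0 : ℝ) < m + 1 := by positivity
  have h := mul_ne_zero_iff.1 hx
  have h1 : 1 < (m + 1) * x := not_le.1 fun h' => h.1 (smoothStep_of_le h')
  have h2 : 1 < (m + 1) * (1 - x) := not_le.1 fun h' => h.2 (smoothStep_of_le h')
  constructor
  · rw [div_le_iff₀ hm]; linarith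
  · have : 1 / (m + 1 : ℝ) ≤ 1 - x := by rw [div_le_iff₀ hm]; linarith
    linarith

theorem eventually_cutoff_eventuallyEq_one {x : ℝ} (hx : x ∈ Ioo (0 : ℝ) 1) :
    ∀ᶠ m : ℕ in atTop, cutoff m =ᶠ[𝓝 x] fun _ => 1 := by
  have h1 : 0 < 1 - x := by linarith [hx.2]
  have e1 := (tendsto_natCast_atTop_atTop (R := ℝ)).eventually (eventually_ge_atTop (4 / x))
  have e2 := (tendsto_natCast_atTop_atTop (R := ℝ)).eventually (eventually_ge_atTop (4 / (1 - x)))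
  filter_upwards [e1, e2] with m hm1 hm2
  rw [div_le_iff₀ hx.1] at hm1
  rw [div_le_iff₀ h1] at hm2
  have n1 : ∀ᶠ y in 𝓝 x, x / 2 < y := lt_mem_nhds (by linarith [hx.1])
  have n2 : ∀ᶠ y in 𝓝 x, y < (1 + x) / 2 := gt_mem_nhds (by linarith)
  filter_upwards [n1, n2] with y hy1 hy2
  have hm0 : (0 : ℝ) ≤ m := Nat.cast_nonneg m
  rw [cutoff, smoothStep_of_ge, smoothStep_of_ge, one_mul]
  · nlinarith [mul_le_mul_of_nonneg_left hy2.le hm0]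
  · nlinarith [mul_le_mul_of_nonneg_left hy1.le hm0, hx.1]

theorem iteratedDeriv_rho_mul_eval (k : ℕ) (c d : ℝ) (p : Polynomial ℝ) {x : ℝ}
    (hx : x ∈ Ioo (0 : ℝ) 1) :
    iteratedDeriv k (fun y => rho c d y * p.eval y) x =
      rho (c - k) (d - k) x * (iterWeightedDeriv k (c - k) (d - k) p).eval x := by
  induction k generalizing x with
  | zero => simp [iterWeightedDeriv]
  | succ k ih =>
    have e1 : c - k = c - (k + 1 : ℕ) + 1 := by push_cast; ring
    have e2 : d - k = d - (k + 1 : ℕ) + 1 := by push_cast; ring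
    rw [iteratedDeriv_succ, iterWeightedDeriv, ← (hasDerivAt_rho_mul_eval _ _ _ hx).deriv]
    refine Filter.EventuallyEq.deriv_eq ?_
    filter_upwards [isOpen_Ioo.mem_nhds hx] with y hy
    rw [ih hy, e1, e2]

theorem rho_sub_natCast_mul (k : ℕ) (c d : ℝ) {x : ℝ} (hx : x ∈ Ioo (0 : ℝ) 1) :
    (x * (1 - x)) ^ k * rho (c - k) (d - k) x = rho c d x := by
  have := rho_add (c - k) (d - k) k k hx
  rw [sub_add_cancel, sub_add_cancel, rho_natCast] at this
  rw [this, mul_comm]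

/-- The `k`-th derivative is `ρ^{(c-k,d-k)}` times a polynomial bounded on `[0, 1]`, and the factor
`(x(1-x))^k` restores the weight. -/
theorem scaledBound_rho_mul_eval (c d : ℝ) (p : Polynomial ℝ) :
    ScaledBound (rho c d) fun _ x => rho c d x * p.eval x := by
  intro k
  obtain ⟨C, hC⟩ := isCompact_Icc.exists_bound_of_continuousOn (s := Icc (0 : ℝ) 1)
    (f := fun x => (iterWeightedDeriv k (c - k) (d - k) p).eval x)
    (Polynomial.continuous _).continuousOn
  refine ⟨C, fun _ x hx => ?_⟩
  rw [iteratedDeriv_rho_mul_eval k c d p hx, abs_mul, abs_of_pos (rho_pos _ _ hx), ← mul_assoc,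
    rho_sub_natCast_mul k c d hx, mul_comm]
  exact mul_le_mul_of_nonneg_right (hC x (Ioo_subset_Icc_self hx)) (rho_pos _ _ hx).le

theorem contDiffAt_rho_mul_eval (c d : ℝ) (p : Polynomial ℝ) {x : ℝ} (hx : x ∈ Ioo (0 : ℝ) 1) :
    ContDiffAt ℝ ∞ (fun x => rho c d x * p.eval x) x :=
  (contDiffAt_rho c d hx).mul (p.contDiff_aeval ∞).contDiffAt

/-- A weak derivative can be tested against `ρ^{(A+j,B+j)} p`, which need not have compact support
in `(0,1)`. -/
theorem IsWeakDeriv.integral_rho_mul {j : ℕ} {f w : ℝ → ℝ} (h : IsWeakDeriv j f w) {A B : ℝ}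
    (hf : IntegrableOn (fun x => rho A B x * f x) (Ioo 0 1))
    (hw : IntegrableOn (fun x => rho (A + j) (B + j) x * w x) (Ioo 0 1)) (p : Polynomial ℝ) :
    ∫ x in Ioo (0 : ℝ) 1, rho A B x * (f x * (iterWeightedDeriv j A B p).eval x) =
      (-1) ^ j * ∫ x in Ioo (0 : ℝ) 1, rho (A + j) (B + j) x * (w x * p.eval x) := by
  set φ : ℝ → ℝ := fun x => rho (A + j) (B + j) x * p.eval x with hφ
  set Φ : ℕ → ℝ → ℝ := fun m x => cutoff m x * φ x with hΦ
  have hΦs : ∀ m, tsupport (Φ m) ⊆ Icc (1 / (m + 1 : ℝ)) (1 - 1 / (m + 1 : ℝ)) := fun m =>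
    closure_minimal (fun x hx => support_cutoff_subset m (left_ne_zero_of_mul hx)) isClosed_Icc
  have hΦI : ∀ m, tsupport (Φ m) ⊆ Ioo (0 : ℝ) 1 := fun m x hx => by
    have h1 := hΦs m hx
    have h2 : (0 : ℝ) < 1 / (m + 1 : ℝ) := by positivity
    exact ⟨h2.trans_le h1.1, by linarith [h1.2]⟩
  have hΦat : ∀ m, ∀ x ∈ Ioo (0 : ℝ) 1, ContDiffAt ℝ ∞ (Φ m) x := fun m x hx =>
    (contDiff_cutoff m).contDiffAt.mul (contDiffAt_rho_mul_eval _ _ p hx)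
  -- The weight may fail to be smooth at `0` and `1`, but those points lie off the support, where
  -- the product is locally zero.
  have hΦc : ∀ m, ContDiff ℝ ∞ (Φ m) := fun m =>
    contDiff_iff_contDiffAt.2 fun x => by
      by_cases hx : x ∈ tsupport (Φ m)
      · exact hΦat m x (hΦI m hx)
      · exact contDiffAt_const.congr_of_eventuallyEq (notMem_tsupport_iff_eventuallyEq.1 hx)
  have hid := fun m => h.2.2 (Φ m) (hΦc m)
    (isCompact_Icc.of_isClosed_subset (isClosed_tsupport _) (hΦs m)) (hΦI m)
  have hb : ScaledBound (fun x => 1 * 1 * rho (A + j) (B + j) x) Φ :=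
    scaledBound_cutoff.mul (scaledBound_rho_mul_eval _ _ p)
      (fun m x _ => (contDiff_cutoff m).contDiffAt)
      fun _ x hx => contDiffAt_rho_mul_eval _ _ p hx
  have hlim : ∀ k : ℕ, ∀ x ∈ Ioo (0 : ℝ) 1,
      Tendsto (fun m => iteratedDeriv k (Φ m) x) atTop (𝓝 (iteratedDeriv k φ x)) := by
    intro k x hx
    -- Near a fixed `x` the cutoff is eventually identically `1`, so the sequence is eventually
    -- constant.
    refine tendsto_const_nhds.congr' ?_
    filter_upwards [eventually_cutoff_eventuallyEq_one hx] with m hm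
    refine (Filter.EventuallyEq.iteratedDeriv_eq k ?_).symm
    filter_upwards [hm] with y hy
    simp only [hΦ, hy, one_mul]
  have L1 : Tendsto (fun m => ∫ x in Ioo (0 : ℝ) 1, f x * iteratedDeriv j (Φ m) x) atTop
      (𝓝 (∫ x in Ioo (0 : ℝ) 1, rho A B x * (f x * (iterWeightedDeriv j A B p).eval x))) := by
    obtain ⟨C, hC⟩ := hb j
    refine tendsto_integral_of_dominated_convergence (fun x => C * ‖rho A B x * f x‖)
      (fun m => h.1.aestronglyMeasurable.mul ((hΦc m).continuous_iteratedDeriv j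
        (mod_cast le_top)).aestronglyMeasurable) (hf.norm.const_mul C) (fun m => ?_) ?_
    · filter_upwards [ae_restrict_mem measurableSet_Ioo] with x hx
      have hd : 0 < (x * (1 - x)) ^ j := pow_pos (mul_pos hx.1 (by linarith [hx.2])) _
      have h1 := hC m x hx
      beta_reduce at h1
      rw [one_mul, one_mul, rho_add A B j j hx, rho_natCast, mul_comm (rho A B x), mul_left_comm]
        at h1
      -- Cancelling `(x(1-x))^j` against the raised weight leaves `|Φ_m^{(j)}| ≤ C ρ^{(A,B)}`, so `C
      -- |ρ^{(A,B)} f|` dominates uniformly in `m`.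
      have h2 := le_of_mul_le_mul_left h1 hd
      rw [norm_mul, norm_mul, Real.norm_eq_abs (rho A B x), abs_of_pos (rho_pos A B hx),
        ← mul_assoc, mul_comm]
      exact mul_le_mul_of_nonneg_right h2 (norm_nonneg _)
    · filter_upwards [ae_restrict_mem measurableSet_Ioo] with x hx
      have h1 := (hlim j x hx).const_mul (f x)
      rw [hφ, iteratedDeriv_rho_mul_eval j _ _ p hx, add_sub_cancel_right,
        add_sub_cancel_right] at h1
      convert h1 using 2
      ring
  have L2 : Tendsto (fun m => ∫ x in Ioo (0 : ℝ) 1, w x * Φ m x) atTop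
      (𝓝 (∫ x in Ioo (0 : ℝ) 1, rho (A + j) (B + j) x * (w x * p.eval x))) := by
    obtain ⟨C, hC⟩ := hb 0
    refine tendsto_integral_of_dominated_convergence
      (fun x => C * ‖rho (A + j) (B + j) x * w x‖)
      (fun m => h.2.1.aestronglyMeasurable.mul (hΦc m).continuous.aestronglyMeasurable)
      (hw.norm.const_mul C) (fun m => ?_) ?_
    · filter_upwards [ae_restrict_mem measurableSet_Ioo] with x hx
      have h1 := hC m x hx
      beta_reduce at h1
      rw [pow_zero, one_mul, one_mul, one_mul, iteratedDeriv_zero] at h1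
      rw [norm_mul, norm_mul (rho (A + j) (B + j) x), Real.norm_eq_abs (rho _ _ x),
        abs_of_pos (rho_pos _ _ hx),
        ← mul_assoc, mul_comm]
      exact mul_le_mul_of_nonneg_right h1 (norm_nonneg _)
    · filter_upwards [ae_restrict_mem measurableSet_Ioo] with x hx
      have h1 := (hlim 0 x hx).const_mul (w x)
      simp only [iteratedDeriv_zero] at h1
      convert h1 using 2
      simp only [hφ]; ring
  refine tendsto_nhds_unique L1 ?_
  simp only [hid]
  exact L2.const_mul _

/-! ### Weak derivatives of `L²` limits of polynomials -/

theorem integrableOn_rho_mul_of_memLp {a b : ℝ} (ha : -1 < a) (hb : -1 < b) {v : ℝ → ℝ}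
    (hv : MemLp v 2 (nu a b)) : IntegrableOn (fun x => rho a b x * v x) (Ioo 0 1) := by
  have := isFiniteMeasure_nu ha hb
  exact (integrable_nu_iff a b v).1 (hv.integrable (by norm_num))

theorem continuousOn_rho (a b : ℝ) : ContinuousOn (rho a b) (Ioo 0 1) := fun _ hx =>
  (contDiffAt_rho (n := 0) a b hx).continuousAt.continuousWithinAt

theorem locallyIntegrableOn_of_memLp_nu {a b : ℝ} (ha : -1 < a) (hb : -1 < b) {v : ℝ → ℝ}
    (hv : MemLp v 2 (nu a b)) : LocallyIntegrableOn v (Ioo 0 1) := by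
  rw [locallyIntegrableOn_iff isOpen_Ioo.isLocallyClosed]
  intro K hK hKc
  have h1 := (integrableOn_rho_mul_of_memLp ha hb hv).mono_set hK
  have h2 : ContinuousOn (fun x => (rho a b x)⁻¹) K :=
    ((continuousOn_rho a b).mono hK).inv₀ fun x hx => (rho_pos a b (hK hx)).ne'
  refine (h1.continuousOn_mul h2 hKc).congr_fun (fun x hx => ?_) hKc.measurableSet
  exact inv_mul_cancel_left₀ (rho_pos a b (hK hx)).ne' _

/-- The function `ψ / ρ` is bounded because `ψ` is supported in a compact subset of the open
interval. It therefore lies in `L²(nu a b)`, and Cauchy–Schwarz applies. -/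
theorem tendsto_integral_mul_of_tendsto_eLpNorm {a b : ℝ} (ha : -1 < a) (hb : -1 < b)
    {v : ℝ → ℝ} {u : ℕ → ℝ → ℝ} (hv : MemLp v 2 (nu a b)) (hu : ∀ m, MemLp (u m) 2 (nu a b))
    (h : Tendsto (fun m => eLpNorm (fun x => u m x - v x) 2 (nu a b)) atTop (𝓝 0)) {ψ : ℝ → ℝ}
    (hψ : Continuous ψ) (hc : HasCompactSupport ψ) (hs : tsupport ψ ⊆ Ioo (0 : ℝ) 1) :
    Tendsto (fun m => ∫ x in Ioo (0 : ℝ) 1, u m x * ψ x) atTop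
      (𝓝 (∫ x in Ioo (0 : ℝ) 1, v x * ψ x)) := by
  have := isFiniteMeasure_nu ha hb
  have e : ∀ g : ℝ → ℝ, ∫ x in Ioo (0 : ℝ) 1, g x * ψ x =
      ∫ x, g x * ((rho a b x)⁻¹ * ψ x) ∂nu a b := fun g => by
    rw [integral_nu]
    refine setIntegral_congr_fun measurableSet_Ioo fun x hx => ?_
    have := (rho_pos a b hx).ne'
    field_simp
  obtain ⟨C, hC⟩ := IsCompact.exists_bound_of_continuousOn (s := tsupport ψ) hc
    (f := fun x => (rho a b x)⁻¹ * ψ x)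
    ((((continuousOn_rho a b).mono hs).inv₀ fun x hx => (rho_pos a b (hs hx)).ne').mul
      hψ.continuousOn)
  have hM : MemLp (fun x => (rho a b x)⁻¹ * ψ x) 2 (nu a b) := by
    refine MemLp.of_bound ((measurable_rho a b).inv.mul hψ.measurable).aestronglyMeasurable
      (max C 0) (ae_of_all _ fun x => ?_)
    by_cases hx : x ∈ tsupport ψ
    · exact (hC x hx).trans (le_max_left _ _)
    · simp [image_eq_zero_of_notMem_tsupport hx]
  simp only [e]
  refine tendsto_integral_of_L1' _ (hv.integrable_mul hM).1
    (Eventually.of_forall fun m => (hu m).integrable_mul hM) ?_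
  have hlim : Tendsto (fun m => eLpNorm (fun x => u m x - v x) 2 (nu a b) *
      eLpNorm (fun x => (rho a b x)⁻¹ * ψ x) 2 (nu a b)) atTop (𝓝 0) := by
    simpa using ENNReal.Tendsto.mul_const h (Or.inr hM.2.ne)
  refine tendsto_of_tendsto_of_tendsto_of_le_of_le tendsto_const_nhds hlim
    (fun _ => zero_le) fun m => ?_
  have h3 := eLpNorm_smul_le_mul_eLpNorm (p := 2) (q := 2) (r := 1) hM.1
    ((hu m).sub hv).1
  refine le_trans (le_of_eq ?_) h3
  congr 1
  ext x
  simp only [Pi.sub_apply, Pi.mul_apply, Pi.smul_apply', smul_eq_mul, sub_mul]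

theorem tsupport_iteratedDeriv_subset_tsupport (φ : ℝ → ℝ) (l : ℕ) :
    tsupport (iteratedDeriv l φ) ⊆ tsupport φ := by
  induction l with
  | zero => simp
  | succ l ih =>
    rw [iteratedDeriv_succ]
    exact (closure_minimal support_deriv_subset (isClosed_tsupport _)).trans ih

theorem integral_eval_mul_iteratedDeriv (P : Polynomial ℝ) (l : ℕ) {φ : ℝ → ℝ}
    (hφ : ContDiff ℝ ∞ φ) (hc : HasCompactSupport φ) :
    ∫ x, P.eval x * iteratedDeriv l φ x =
      (-1) ^ l * ∫ x, (Polynomial.derivative^[l] P).eval x * φ x := by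
  induction l generalizing P with
  | zero => simp
  | succ l ih =>
    have hcl : ∀ k, HasCompactSupport (iteratedDeriv k φ) := fun k =>
      hc.of_isClosed_subset (isClosed_tsupport _) (tsupport_iteratedDeriv_subset_tsupport φ k)
    have hcont : ∀ k, Continuous (iteratedDeriv k φ) := fun k =>
      hφ.continuous_iteratedDeriv k (mod_cast le_top)
    have hint : ∀ (Q : Polynomial ℝ) (k : ℕ),
        Integrable (fun x => Q.eval x * iteratedDeriv k φ x) := fun Q k =>
      (Q.continuous.mul (hcont k)).integrable_of_hasCompactSupport (hcl k).mul_left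
    have h := integral_mul_deriv_eq_deriv_mul_of_integrable (u := fun x => P.eval x)
      (v := iteratedDeriv l φ) (u' := fun x => P.derivative.eval x) (v' := iteratedDeriv (l + 1) φ)
      (fun x _ => P.hasDerivAt x) (fun x _ => ?_) (hint _ _) (hint _ _) (hint _ _)
    · rw [h, ih, Function.iterate_succ_apply]
      ring
    · rw [iteratedDeriv_succ]
      exact ((hφ.differentiable_iteratedDeriv l (mod_cast ENat.natCast_lt_top l)) x).hasDerivAt

/-- `L²` limits of polynomials and of their derivatives are related by a weak derivative. -/
theorem isWeakDeriv_of_tendsto {a b a' b' : ℝ} (ha : -1 < a) (hb : -1 < b) (ha' : -1 < a')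
    (hb' : -1 < b') {l : ℕ} {v w : ℝ → ℝ} {P : ℕ → Polynomial ℝ} (hv : MemLp v 2 (nu a b))
    (hw : MemLp w 2 (nu a' b'))
    (hPv : Tendsto (fun m => eLpNorm (fun x => (P m).eval x - v x) 2 (nu a b)) atTop (𝓝 0))
    (hPw : Tendsto (fun m => eLpNorm (fun x => (Polynomial.derivative^[l] (P m)).eval x - w x) 2
      (nu a' b')) atTop (𝓝 0)) : IsWeakDeriv l v w := by
  refine ⟨locallyIntegrableOn_of_memLp_nu ha hb hv, locallyIntegrableOn_of_memLp_nu ha' hb' hw,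
    fun φ hφ hc hs => ?_⟩
  have hs' := (tsupport_iteratedDeriv_subset_tsupport φ l).trans hs
  have hc' : HasCompactSupport (iteratedDeriv l φ) :=
    hc.of_isClosed_subset (isClosed_tsupport _) (tsupport_iteratedDeriv_subset_tsupport φ l)
  have L1 := tendsto_integral_mul_of_tendsto_eLpNorm ha hb hv (fun m => memLp_eval ha hb (P m)) hPv
    (hφ.continuous_iteratedDeriv l (mod_cast le_top)) hc' hs'
  have L2 := (tendsto_integral_mul_of_tendsto_eLpNorm ha' hb' hw
    (fun m => memLp_eval ha' hb' (Polynomial.derivative^[l] (P m))) hPw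
    hφ.continuous hc hs).const_mul ((-1) ^ l)
  refine tendsto_nhds_unique L1 (L2.congr fun m => ?_)
  have hz : ∀ (g ψ : ℝ → ℝ), tsupport ψ ⊆ Ioo (0 : ℝ) 1 →
      ∫ x in Ioo (0 : ℝ) 1, g x * ψ x = ∫ x, g x * ψ x := fun g ψ h =>
    setIntegral_eq_integral_of_forall_compl_eq_zero fun x hx => by
      rw [image_eq_zero_of_notMem_tsupport fun h' => hx (h h'), mul_zero]
  rw [hz _ _ hs, hz _ _ hs', integral_eval_mul_iteratedDeriv _ _ hφ hc]

/-! ### Bessel's inequality and orthogonal series -/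

section Hilbert

variable {H : Type*} [NormedAddCommGroup H] [InnerProductSpace ℝ H]

theorem norm_sq_sum_of_pairwise_orthogonal {ι : Type*} {x : ι → H}
    (hx : ∀ i k, i ≠ k → inner ℝ (x i) (x k) = 0) (s : Finset ι) :
    ‖∑ i ∈ s, x i‖ ^ 2 = ∑ i ∈ s, ‖x i‖ ^ 2 := by
  rw [← real_inner_self_eq_norm_sq, sum_inner]
  refine Finset.sum_congr rfl fun i hi => ?_
  rw [inner_sum, Finset.sum_eq_single_of_mem i hi fun k _ hk => hx i k hk.symm,
    real_inner_self_eq_norm_sq]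

theorem sum_inner_sq_div_le_of_pairwise_orthogonal {ι : Type*} {x : ι → H}
    (hx : ∀ i k, i ≠ k → inner ℝ (x i) (x k) = 0) (g : H) (s : Finset ι) :
    ∑ i ∈ s, inner ℝ g (x i) ^ 2 / ‖x i‖ ^ 2 ≤ ‖g‖ ^ 2 := by
  set y : ι → H := fun i => (inner ℝ g (x i) / ‖x i‖ ^ 2) • x i with hy
  have h1 : ‖∑ i ∈ s, y i‖ ^ 2 = ∑ i ∈ s, inner ℝ g (x i) ^ 2 / ‖x i‖ ^ 2 := by
    rw [norm_sq_sum_of_pairwise_orthogonal fun i k hik => by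
      rw [hy, inner_smul_left, inner_smul_right, hx i k hik, mul_zero, mul_zero]]
    refine Finset.sum_congr rfl fun i _ => ?_
    rw [hy, norm_smul, mul_pow, Real.norm_eq_abs, sq_abs]
    -- Zero vectors are allowed, with quotient `0`: derivatives annihilate the polynomials of low
    -- degree.
    by_cases h : ‖x i‖ = 0
    · simp [h]
    · field_simp
  have h2 : inner ℝ g (∑ i ∈ s, y i) = ∑ i ∈ s, inner ℝ g (x i) ^ 2 / ‖x i‖ ^ 2 := by
    rw [inner_sum]
    refine Finset.sum_congr rfl fun i _ => ?_
    rw [hy, inner_smul_right]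
    ring
  have h3 := norm_sub_sq_real g (∑ i ∈ s, y i)
  rw [h1, h2] at h3
  have := sq_nonneg ‖g - ∑ i ∈ s, y i‖
  linarith

theorem exists_tendsto_sum_of_pairwise_orthogonal [CompleteSpace H] {x : ℕ → H}
    (hx : ∀ i k, i ≠ k → inner ℝ (x i) (x k) = 0) {S : ℝ} (hS : 0 ≤ S)
    (h : ∀ m, ∑ i ∈ Finset.range m, ‖x i‖ ^ 2 ≤ S ^ 2) :
    ∃ y : H, Tendsto (fun m => ∑ i ∈ Finset.range m, x i) atTop (𝓝 y) ∧ ‖y‖ ≤ S := by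
  -- Without normalization, the spanned lines form the orthogonal family, even where a line is
  -- trivial.
  have hV : OrthogonalFamily ℝ (fun i => ℝ ∙ x i) fun i => (ℝ ∙ x i).subtypeₗᵢ := by
    refine OrthogonalFamily.of_pairwise fun i k hik => ?_
    rw [Function.onFun, Submodule.isOrtho_span]
    rintro u hu v hv
    rw [mem_singleton_iff.1 hu, mem_singleton_iff.1 hv, hx i k hik]
  have hsum : Summable x := by
    have := (hV.summable_iff_norm_sq_summable
      fun i => ⟨x i, Submodule.mem_span_singleton_self _⟩).2
      (summable_of_sum_range_le (fun _ => by positivity) h)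
    exact this
  refine ⟨_, hsum.hasSum.tendsto_sum_nat, ?_⟩
  refine le_of_tendsto hsum.hasSum.tendsto_sum_nat.norm (Eventually.of_forall fun m => ?_)
  have := h m
  rw [← norm_sq_sum_of_pairwise_orthogonal hx] at this
  exact le_of_sq_le_sq this hS

end Hilbert

/-- The class of a polynomial in the weighted `L²` space. -/
def polyLp {a b : ℝ} (ha : -1 < a) (hb : -1 < b) : Polynomial ℝ →ₗ[ℝ] Lp ℝ 2 (nu a b) where
  toFun p := (memLp_eval ha hb p).toLp _
  map_add' p q := by
    rw [← MemLp.toLp_add]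
    congr 1
    ext x
    simp
  map_smul' c p := by
    rw [RingHom.id_apply, ← MemLp.toLp_const_smul]
    congr 1
    ext x
    simp

theorem inner_polyLp {a b : ℝ} (ha : -1 < a) (hb : -1 < b) {g : ℝ → ℝ}
    (hg : MemLp g 2 (nu a b)) (p : Polynomial ℝ) :
    inner ℝ (hg.toLp g) (polyLp ha hb p) =
      ∫ x in Ioo (0 : ℝ) 1, rho a b x * (g x * p.eval x) := by
  rw [L2.inner_def, ← integral_nu]
  refine integral_congr_ae ?_
  filter_upwards [hg.coeFn_toLp, (memLp_eval ha hb p).coeFn_toLp] with x h1 h2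
  rw [h1, polyLp, LinearMap.coe_mk, AddHom.coe_mk, h2]
  simp [mul_comm]

theorem inner_polyLp_polyLp {a b : ℝ} (ha : -1 < a) (hb : -1 < b) (p q : Polynomial ℝ) :
    inner ℝ (polyLp ha hb p) (polyLp ha hb q) = wInt a b (p * q) := by
  rw [wInt]
  refine (inner_polyLp ha hb (memLp_eval ha hb p) q).trans ?_
  simp

theorem norm_sq_polyLp {a b : ℝ} (ha : -1 < a) (hb : -1 < b) (p : Polynomial ℝ) :
    ‖polyLp ha hb p‖ ^ 2 = wInt a b (p * p) := by
  rw [← real_inner_self_eq_norm_sq, inner_polyLp_polyLp]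

theorem sum_sq_div_wInt_le {a b : ℝ} (ha : -1 < a) (hb : -1 < b) {P : ℕ → Polynomial ℝ}
    (hP : ∀ i k, i ≠ k → wInt a b (P i * P k) = 0) {g : ℝ → ℝ} (hg : MemLp g 2 (nu a b))
    (s : Finset ℕ) :
    ∑ i ∈ s, (∫ x in Ioo (0 : ℝ) 1, rho a b x * (g x * (P i).eval x)) ^ 2 / wInt a b (P i * P i) ≤
      (eLpNorm g 2 (nu a b)).toReal ^ 2 := by
  have h := sum_inner_sq_div_le_of_pairwise_orthogonal (x := fun i => polyLp ha hb (P i))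
    (fun i k hik => by rw [inner_polyLp_polyLp, hP i k hik]) (hg.toLp g) s
  simpa only [inner_polyLp, norm_sq_polyLp, Lp.norm_toLp] using h

theorem exists_tendsto_sum_eval {a b : ℝ} (ha : -1 < a) (hb : -1 < b) {P : ℕ → Polynomial ℝ}
    (hP : ∀ i k, i ≠ k → wInt a b (P i * P k) = 0) {S : ℝ} (hS : 0 ≤ S)
    (h : ∀ m, ∑ i ∈ Finset.range m, wInt a b (P i * P i) ≤ S ^ 2) :
    ∃ y : ℝ → ℝ, MemLp y 2 (nu a b) ∧
      Tendsto (fun m => eLpNorm (fun x => (∑ i ∈ Finset.range m, P i).eval x - y x) 2 (nu a b))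
        atTop (𝓝 0) ∧ eLpNorm y 2 (nu a b) ≤ ENNReal.ofReal S := by
  obtain ⟨y, hy, hn⟩ := exists_tendsto_sum_of_pairwise_orthogonal
    (x := fun i => polyLp ha hb (P i))
    (fun i k hik => by rw [inner_polyLp_polyLp, hP i k hik]) hS
    (fun m => by simpa only [norm_sq_polyLp] using h m)
  refine ⟨y, Lp.memLp y, ?_, ?_⟩
  · have h1 : Tendsto (fun m => (memLp_eval ha hb (∑ i ∈ Finset.range m, P i)).toLp _) atTop
        (𝓝 ((Lp.memLp y).toLp y)) := by
      rw [Lp.toLp_coeFn]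
      refine hy.congr fun m => ?_
      rw [← map_sum]
      rfl
    exact (Lp.tendsto_Lp_iff_tendsto_eLpNorm'' _ _ _ _).1 h1
  · rw [← ENNReal.ofReal_toReal (Lp.memLp y).2.ne, ← Lp.norm_def]
    exact ENNReal.ofReal_le_ofReal hn

/-! ### Bessel's inequality for the weak derivative of the data -/

theorem wInt_iterate_derivative_jacobiPoly_of_ne {a b : ℝ} (ha : -1 < a) (hb : -1 < b) (l : ℕ)
    {m n : ℕ} (h : m ≠ n) :
    wInt (a + l) (b + l) (Polynomial.derivative^[l] (jacobiPoly m a b) *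
      Polynomial.derivative^[l] (jacobiPoly n a b)) = 0 := by
  rw [wInt_iterate_derivative_mul ha hb, wInt_jacobiPoly_mul_of_ne ha hb h, mul_zero]

/-- Testing `w` against `D^j G_n` moves the derivatives onto the weighted polynomial, where the
eigenvalue identity applies. Its sign `(-1)^j` cancels the one in the weak derivative. -/
theorem integral_rho_mul_iterate_derivative {j : ℕ} {f w : ℝ → ℝ} (h : IsWeakDeriv j f w)
    {A B : ℝ} (hA : -1 < A) (hB : -1 < B) (hf : MemLp f 2 (nu A B))
    (hw : MemLp w 2 (nu (A + j) (B + j))) (n : ℕ) :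
    ∫ x in Ioo (0 : ℝ) 1, rho (A + j) (B + j) x *
        (w x * (Polynomial.derivative^[j] (jacobiPoly n A B)).eval x) =
      slEigen n j (A + B) * ∫ x in Ioo (0 : ℝ) 1, rho A B x * f x * jacobiG n A B x := by
  have hj : (0 : ℝ) ≤ j := Nat.cast_nonneg j
  have h1 := h.integral_rho_mul (integrableOn_rho_mul_of_memLp hA hB hf)
    (integrableOn_rho_mul_of_memLp (by linarith) (by linarith) hw)
    (Polynomial.derivative^[j] (jacobiPoly n A B))
  have h2 : ∀ x, rho A B x * (f x * (iterWeightedDeriv j A B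
      (Polynomial.derivative^[j] (jacobiPoly n A B))).eval x) =
      (-1) ^ j * (slEigen n j (A + B) * (rho A B x * f x * jacobiG n A B x)) := fun x => by
    rw [iterWeightedDeriv_derivative_jacobiPoly, Polynomial.eval_mul, Polynomial.eval_C,
      eval_jacobiPoly]
    ring
  simp only [h2, integral_const_mul] at h1
  exact (mul_left_cancel₀ (pow_ne_zero _ (by norm_num)) h1).symm

theorem sum_slEigen_mul_sq_div_le {j : ℕ} {f w : ℝ → ℝ} (h : IsWeakDeriv j f w)
    {A B : ℝ} (hA : -1 < A) (hB : -1 < B) (hf : MemLp f 2 (nu A B))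
    (hw : MemLp w 2 (nu (A + j) (B + j))) (s : Finset ℕ) :
    ∑ n ∈ s, slEigen n j (A + B) * ((∫ x in Ioo (0 : ℝ) 1, rho A B x * f x * jacobiG n A B x) ^ 2 /
      jacobiNormSq n A B) ≤ (eLpNorm w 2 (nu (A + j) (B + j))).toReal ^ 2 := by
  have hj : (0 : ℝ) ≤ j := Nat.cast_nonneg j
  refine le_trans (le_of_eq (Finset.sum_congr rfl fun n _ => ?_))
    (sum_sq_div_wInt_le (by linarith) (by linarith)
      (P := fun n => Polynomial.derivative^[j] (jacobiPoly n A B))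
      (fun i k hik => wInt_iterate_derivative_jacobiPoly_of_ne hA hB j hik) hw s)
  rw [integral_rho_mul_iterate_derivative h hA hB hf hw, wInt_iterate_derivative_mul hA hB,
    ← jacobiNormSq_eq_wInt]
  have := (jacobiNormSq_pos hA hB n).ne'
  -- The Bessel term is `(E f_n)² / (E H_n)`, which reduces to `E f_n² / H_n`. The case `E = 0`
  -- occurs when `n < j`.
  by_cases h0 : slEigen n j (A + B) = 0
  · simp [h0]
  · field_simp

/-! ### Lower bounds for `λ_n` -/

theorem rpow_sub_one_le_Gamma_div_factorial {α : ℝ} (hα : 1 < α) {i : ℕ} (hi : 1 ≤ i) :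
    (i : ℝ) ^ (α - 1) ≤ Real.Gamma (i + α) / i.factorial := by
  have hi0 : (0 : ℝ) < i := by exact_mod_cast hi
  -- By log-convexity of `Γ`, the slope `log i` of `log Γ` on `[i, i+1]` is at most its slope on
  -- `[i+1, i+α]`.
  have h := Real.convexOn_log_Gamma.slope_mono_adjacent (x := (i : ℝ)) (y := i + 1) (z := i + α)
    hi0 (show (0 : ℝ) < i + α by linarith) (by linarith) (by linarith)
  have hG : Real.Gamma (i + 1) = i * Real.Gamma i := Real.Gamma_add_one hi0.ne'
  have hGi : 0 < Real.Gamma i := Real.Gamma_pos_of_pos hi0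
  have hGα : 0 < Real.Gamma (i + α) := Real.Gamma_pos_of_pos (by linarith)
  simp only [Function.comp_apply] at h
  rw [show (i : ℝ) + 1 - i = 1 by ring, div_one, show (i : ℝ) + α - (i + 1) = α - 1 by ring,
    le_div_iff₀ (by linarith)] at h
  nth_rw 1 [hG] at h
  rw [Real.log_mul hi0.ne' hGi.ne', add_sub_cancel_right, Real.Gamma_nat_eq_factorial] at h
  have hf : (0 : ℝ) < i.factorial := by positivity
  rw [← Real.log_div hGα.ne' hf.ne', mul_comm] at h
  rw [← Real.log_le_log_iff (by positivity) (by positivity), Real.log_rpow hi0]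
  exact h

/-- The factor of `λ_n` that depends on `α` and `β` only. -/
def lamFactor (α β : ℝ) : ℝ :=
  Real.sin (Real.pi * α) / (Real.sin (Real.pi * (α - β)) + Real.sin (Real.pi * β))

/-- With `θ = π(α/2 - β)`, sum-to-product gives `lamFactor α β = cos(πα/2) / cos θ`. The second
bound is `cos θ ≤ 1`. The first uses the relation between `r` and `β`, which becomes `(2r-1)
sin(πα/2) cos θ = -cos(πα/2) sin θ`. -/
theorem lamFactor_lower_bounds {r α β : ℝ} (h1 : 1 < α) (h2 : α < 2) (hβ : α - 1 ≤ β)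
    (hβ' : β ≤ 1) (hr : 1 / 2 ≤ r)
    (h : r = Real.sin (Real.pi * β) /
      (Real.sin (Real.pi * (α - β)) + Real.sin (Real.pi * β))) :
    2 * r - 1 ≤ |lamFactor α β| ∧ -Real.cos (Real.pi * α / 2) ≤ |lamFactor α β| := by
  have hpi := Real.pi_pos
  set θ := Real.pi * (α / 2 - β) with hθ
  set s := Real.sin (Real.pi * α / 2) with hs
  set c := Real.cos (Real.pi * α / 2) with hc
  have e1 : Real.sin (Real.pi * (α - β)) = s * Real.cos θ + c * Real.sin θ := by
    rw [hs, hc, ← Real.sin_add]; congr 1; rw [hθ]; ring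
  have e2 : Real.sin (Real.pi * β) = s * Real.cos θ - c * Real.sin θ := by
    rw [hs, hc, ← Real.sin_sub]; congr 1; rw [hθ]; ring
  have e3 : Real.sin (Real.pi * α) = 2 * s * c := by
    rw [hs, hc, ← Real.sin_two_mul]; congr 1; ring
  have hs0 : 0 < s := Real.sin_pos_of_pos_of_lt_pi (by positivity) (by nlinarith)
  have hc0 : c < 0 := Real.cos_neg_of_pi_div_two_lt_of_lt (by nlinarith) (by nlinarith)
  have hθ0 : 0 < Real.cos θ := Real.cos_pos_of_mem_Ioo ⟨by nlinarith, by nlinarith⟩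
  have hθ1 : Real.cos θ ≤ 1 := Real.cos_le_one θ
  have hL : |lamFactor α β| = -c / Real.cos θ := by
    have : lamFactor α β = c / Real.cos θ := by
      rw [lamFactor, e1, e2, e3]
      field_simp
      ring
    rw [this, abs_div, abs_of_neg hc0, abs_of_pos hθ0]
  have hr' : (2 * r - 1) * (s * Real.cos θ) = -c * Real.sin θ := by
    have hD : s * Real.cos θ + c * Real.sin θ + (s * Real.cos θ - c * Real.sin θ) ≠ 0 := by
      have := mul_pos hs0 hθ0
      nlinarith
    rw [e1, e2, eq_div_iff hD] at h
    linarith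
  rw [hL]
  constructor
  · rw [le_div_iff₀ hθ0]
    refine abs_le_of_sq_le_sq' ?_ (by linarith) |>.2
    have p1 : s ^ 2 + c ^ 2 = 1 := Real.sin_sq_add_cos_sq _
    have p2 := Real.sin_sq_add_cos_sq θ
    have hsq : ((2 * r - 1) * (s * Real.cos θ)) ^ 2 = (-c * Real.sin θ) ^ 2 := by rw [hr']
    have hr1 : r ≤ 1 := by
      rw [h, div_le_one]
      · have : 0 ≤ Real.sin (Real.pi * (α - β)) :=
          Real.sin_nonneg_of_nonneg_of_le_pi (by nlinarith) (by nlinarith)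
        linarith
      · rw [e1, e2]
        have := mul_pos hs0 hθ0
        linarith
    have hr2 : (2 * r - 1) ^ 2 ≤ 1 := by nlinarith
    -- Multiplying by `s² + c² = 1` isolates the term `s²`, which the relation for `r` rewrites as
    -- `c² sin² θ`.
    calc ((2 * r - 1) * Real.cos θ) ^ 2
        = ((2 * r - 1) * Real.cos θ) ^ 2 * (s ^ 2 + c ^ 2) := by rw [p1, mul_one]
      _ = c ^ 2 * Real.sin θ ^ 2 + (2 * r - 1) ^ 2 * (c ^ 2 * Real.cos θ ^ 2) := by
          linear_combination hsq
      _ ≤ c ^ 2 * Real.sin θ ^ 2 + 1 * (c ^ 2 * Real.cos θ ^ 2) := by gcongr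
      _ = (-c) ^ 2 := by linear_combination c ^ 2 * p2
  · rw [le_div_iff₀ hθ0]
    nlinarith

/-- For `r > 1/2` the bound `2r - 1` is uniform in `α`. At `r = 1/2` it degenerates, and
`-cos(πα/2)`, increasing in `α`, is bounded below by its value at `α₀ > 1`. -/
theorem exists_lam_lower_bound {r : ℝ} (hr : 1 / 2 ≤ r) {α₀ : ℝ} (hα₀ : 1 ≤ α₀)
    (hrα₀ : r = 1 / 2 → 1 < α₀) :
    ∃ c : ℝ, 0 < c ∧ ∀ α β : ℝ, 1 < α → α < 2 → α₀ ≤ α → α - 1 ≤ β → β ≤ 1 →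
      r = Real.sin (Real.pi * β) /
        (Real.sin (Real.pi * (α - β)) + Real.sin (Real.pi * β)) →
      ∀ i : ℕ, 1 ≤ i → c * (i : ℝ) ^ (α - 1) ≤ |lam α β i| := by
  have hpi := Real.pi_pos
  obtain ⟨c, hc, hcb⟩ : ∃ c : ℝ, 0 < c ∧ ∀ α β : ℝ, 1 < α → α < 2 → α₀ ≤ α → α - 1 ≤ β → β ≤ 1 →
      r = Real.sin (Real.pi * β) /
        (Real.sin (Real.pi * (α - β)) + Real.sin (Real.pi * β)) → c ≤ |lamFactor α β| := by
    rcases hr.lt_or_eq with h | h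
    · exact ⟨2 * r - 1, by linarith, fun α β h1 h2 _ hβ hβ' he =>
        (lamFactor_lower_bounds h1 h2 hβ hβ' hr he).1⟩
    · have h0 := hrα₀ h.symm
      rcases lt_or_ge α₀ 2 with h3 | h3
      · refine ⟨-Real.cos (Real.pi * α₀ / 2), ?_, fun α β h1 h2 hα hβ hβ' he => ?_⟩
        · exact neg_pos.2 (Real.cos_neg_of_pi_div_two_lt_of_lt (by nlinarith) (by nlinarith))
        · refine le_trans ?_ (lamFactor_lower_bounds h1 h2 hβ hβ' hr he).2
          exact neg_le_neg (Real.cos_le_cos_of_nonneg_of_le_pi (by positivity) (by nlinarith)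
            (by nlinarith))
      -- No admissible `α` exists when `α₀ ≥ 2`, so any positive constant serves.
      · exact ⟨1, one_pos, fun α β _ h2 hα => absurd h2 (by linarith)⟩
  refine ⟨c, hc, fun α β h1 h2 hα hβ hβ' he i hi => ?_⟩
  have hG := rpow_sub_one_le_Gamma_div_factorial h1 hi
  have hG0 : 0 ≤ Real.Gamma (i + α) / i.factorial := le_trans (by positivity) hG
  have : lam α β i = lamFactor α β * (Real.Gamma (i + α) / i.factorial) := rfl
  rw [this, abs_mul, abs_of_nonneg hG0]
  exact mul_le_mul (hcb α β h1 h2 hα hβ hβ' he) hG (by positivity) (abs_nonneg _)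

/-! ### Termwise comparison of error and data -/

theorem slEigen_le {α : ℝ} (hα : 1 ≤ α) (i l : ℕ) :
    slEigen i l α ≤ (l + 1) ^ l * ((i + 1) * (i + α)) ^ l := by
  have hi : (0 : ℝ) ≤ i := Nat.cast_nonneg i
  rcases lt_or_ge i l with h | h
  · rw [slEigen, Finset.prod_eq_zero (Finset.mem_range.2 h) (by rw [sub_self, zero_mul])]
    positivity
  · rw [← mul_pow, slEigen]
    have e : ((l + 1 : ℝ) * ((i + 1) * (i + α))) ^ l =
        ∏ _k ∈ Finset.range l, ((l + 1 : ℝ) * ((i + 1) * (i + α))) := by simp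
    rw [e]
    refine Finset.prod_le_prod (fun k hk => ?_) fun k hk => ?_
    · have hk1 : (k : ℝ) + 1 ≤ l := by exact_mod_cast Finset.mem_range.1 hk
      have hk2 : (l : ℝ) ≤ i := by exact_mod_cast h
      exact mul_nonneg (by linarith) (by positivity)
    have hk1 : (k : ℝ) + 1 ≤ l := by exact_mod_cast Finset.mem_range.1 hk
    have hk0 : (0 : ℝ) ≤ k := Nat.cast_nonneg k
    have hk2 : (l : ℝ) ≤ i := by exact_mod_cast h
    calc ((i : ℝ) - k) * (i + k + α + 1) ≤ (i + 1) * ((l + 1) * (i + α)) := by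
          refine mul_le_mul (by linarith) ?_ (by positivity) (by positivity)
          nlinarith
      _ = _ := by ring

/-- For `k < j ≤ i + 1` one has `j(i+1-k) ≥ j(i+2-j) ≥ i+1`, the last step being `(j-1)(i+1-j) ≥ 0`.
This is where `N ≥ j - 1` enters: it ensures `j ≤ i + 1` for every tail index `i ≥ N`. -/
theorem pow_le_slEigen {α : ℝ} (hα : 1 ≤ α) {i j : ℕ} (hij : j ≤ i + 1) :
    ((i + 1) * (i + α)) ^ j ≤ (j : ℝ) ^ j * slEigen (i + 1) j (α - 2) := by
  have hi : (0 : ℝ) ≤ i := Nat.cast_nonneg i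
  have hij' : (j : ℝ) ≤ i + 1 := by exact_mod_cast hij
  have e1 : ((i + 1 : ℝ) * (i + α)) ^ j = ∏ _k ∈ Finset.range j, ((i + 1 : ℝ) * (i + α)) := by
    simp
  have e2 : (j : ℝ) ^ j = ∏ _k ∈ Finset.range j, (j : ℝ) := by simp
  rw [e1, e2, slEigen, ← Finset.prod_mul_distrib]
  refine Finset.prod_le_prod (fun k _ => by positivity) fun k hk => ?_
  have hk1 : (k : ℝ) + 1 ≤ j := by exact_mod_cast Finset.mem_range.1 hk
  have hk0 : (0 : ℝ) ≤ k := Nat.cast_nonneg k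
  push_cast
  rw [← mul_assoc]
  refine mul_le_mul ?_ (by linarith) (by positivity) ?_
  · have : (j : ℝ) * (i + 2 - j) ≤ j * (i + 1 - k) :=
      mul_le_mul_of_nonneg_left (by linarith) (Nat.cast_nonneg j)
    nlinarith
  · exact mul_nonneg (by linarith) (by linarith)

theorem slEigen_nonneg {α : ℝ} (hα : 1 ≤ α) {i j : ℕ} (hij : j ≤ i + 1) :
    0 ≤ slEigen (i + 1) j (α - 2) := by
  refine Finset.prod_nonneg fun k hk => ?_
  have hk1 : (k : ℝ) + 1 ≤ j := by exact_mod_cast Finset.mem_range.1 hk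
  have hk0 : (0 : ℝ) ≤ k := Nat.cast_nonneg k
  have hi : (0 : ℝ) ≤ i := Nat.cast_nonneg i
  have hij' : (j : ℝ) ≤ i + 1 := by exact_mod_cast hij
  push_cast
  exact mul_nonneg (by linarith) (by linarith)

/-- With `X = (i+1)(i+α)` and `Y = N(N+α-2)`, the left side is of order at most `X^l ≤ X^μ ≤ Y^(μ-j)
X^j`, because `0 < Y ≤ X`, `1 ≤ X` and `l ≤ μ ≤ j`. The eigenvalue on the right controls `X^j`. -/
theorem slEigen_le_mul_slEigen {α : ℝ} (hα : 1 < α) {i j l μ N : ℕ} (hN : 1 ≤ N) (hi : N ≤ i)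
    (hj : j ≤ N + 1) (hl : l ≤ μ) (hμ : μ ≤ j) :
    slEigen i l α ≤ (μ + 1) ^ μ * j ^ j * ((N : ℝ) * (N + α - 2)) ^ ((μ : ℝ) - j) *
      slEigen (i + 1) j (α - 2) := by
  have hN' : (1 : ℝ) ≤ N := by exact_mod_cast hN
  have hi' : (N : ℝ) ≤ i := by exact_mod_cast hi
  have hY : 0 < (N : ℝ) * (N + α - 2) := mul_pos (by linarith) (by linarith)
  have hXY : (N : ℝ) * (N + α - 2) ≤ (i + 1) * (i + α) :=
    mul_le_mul (by linarith) (by linarith) (by linarith) (by linarith)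
  have hX : 1 ≤ ((i : ℝ) + 1) * (i + α) := by nlinarith
  have hlμ : (l : ℝ) ≤ μ := by exact_mod_cast hl
  have hEj := pow_le_slEigen hα.le (show j ≤ i + 1 by omega)
  generalize hYd : (N : ℝ) * (N + α - 2) = Y at *
  generalize hXd : ((i : ℝ) + 1) * (i + α) = X at *
  have h1 : X ^ μ ≤ Y ^ ((μ : ℝ) - j) * X ^ j := by
    have e : (μ : ℝ) - j = -((j - μ : ℕ) : ℝ) := by rw [Nat.cast_sub hμ]; ring
    rw [e, Real.rpow_neg hY.le, Real.rpow_natCast, ← div_eq_inv_mul, le_div_iff₀ (by positivity)]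
    calc X ^ μ * Y ^ (j - μ) ≤ X ^ μ * X ^ (j - μ) := by gcongr
      _ = X ^ j := by rw [← pow_add, Nat.add_sub_cancel' hμ]
  calc slEigen i l α ≤ (l + 1) ^ l * X ^ l := by
        rw [← hXd]; exact slEigen_le hα.le i l
    _ ≤ (μ + 1) ^ μ * X ^ μ := by
        have h2 : ((l : ℝ) + 1) ^ l ≤ (μ + 1) ^ μ :=
          (pow_le_pow_left₀ (by positivity) (by linarith) l).trans
            (pow_le_pow_right₀ (by linarith [(Nat.cast_nonneg μ : (0 : ℝ) ≤ μ)]) hl)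
        exact mul_le_mul h2 (pow_le_pow_right₀ hX hl) (by positivity) (by positivity)
    _ ≤ (μ + 1) ^ μ * (Y ^ ((μ : ℝ) - j) * (j ^ j * slEigen (i + 1) j (α - 2))) := by
        refine mul_le_mul_of_nonneg_left (h1.trans ?_) (by positivity)
        exact mul_le_mul_of_nonneg_left hEj (by positivity)
    _ = _ := by ring

/-- The norm recursion reads `(i+1) H_{i+1} = (i+α) h_i`, and `α > 1`. -/
theorem jacobiNormSq_le_succ {α β : ℝ} (hα : 1 < α) (hβ : 0 < β) (hαβ : 0 < α - β) (i : ℕ) :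
    jacobiNormSq i (α - β) β ≤ jacobiNormSq (i + 1) (β - 1) (α - β - 1) := by
  have h := jacobiNormSq_succ (a := β - 1) (b := α - β - 1) (by linarith) (by linarith) i
  rw [sub_add_cancel, sub_add_cancel, jacobiNormSq_comm i β] at h
  have h1 := jacobiNormSq_pos (a := α - β) (b := β) (by linarith) (by linarith) i
  have h2 := jacobiNormSq_pos (a := β - 1) (b := α - β - 1) (by linarith) (by linarith) (i + 1)
  have hi : (0 : ℝ) ≤ i := Nat.cast_nonneg i
  rw [show (i : ℝ) + (β - 1) + (α - β - 1) + 2 = i + α by ring] at h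
  have : (i + 1) * jacobiNormSq i (α - β) β ≤
      (i + 1) * jacobiNormSq (i + 1) (β - 1) (α - β - 1) := by
    rw [h]; gcongr
  exact le_of_mul_le_mul_left this (by positivity)

/-- The constant in the error estimate for a single derivative order. -/
def errConst (c : ℝ) (j μ : ℕ) : ℝ := (μ + 1) ^ μ * j ^ j / c

theorem natCast_one_le_self_pow_self (j : ℕ) : (1 : ℝ) ≤ (j : ℝ) ^ j := by
  rcases j with _ | j
  · simp
  · exact one_le_pow₀ (by push_cast; linarith [(Nat.cast_nonneg j : (0 : ℝ) ≤ j)])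

theorem errConst_pos {c : ℝ} (hc : 0 < c) (j μ : ℕ) : 0 < errConst c j μ :=
  div_pos (mul_pos (by positivity) (one_pos.trans_le (natCast_one_le_self_pow_self j))) hc

theorem cCoeff_sq_mul_le {α β c : ℝ} (hα : 1 < α) (hβ : 0 < β) (hαβ : 0 < α - β)
    (hc : 0 < c) {i j l μ N : ℕ} (hN : 1 ≤ N) (hi : N ≤ i) (hj : j ≤ N + 1) (hl : l ≤ μ)
    (hμ : μ ≤ j) (hlam : c * (i : ℝ) ^ (α - 1) ≤ |lam α β i|) (f : ℝ → ℝ) :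
    cCoeff α β f i ^ 2 * (slEigen i l α * jacobiNormSq i (α - β) β) ≤
      (errConst c j μ * (N : ℝ) ^ (-(α - 1)) * ((N : ℝ) * (N + α - 2)) ^ (((μ : ℝ) - j) / 2)) ^ 2 *
      (slEigen (i + 1) j (α - 2) *
        (fCoeff α β f (i + 1) ^ 2 / jacobiNormSq (i + 1) (β - 1) (α - β - 1))) := by
  have hN' : (1 : ℝ) ≤ N := by exact_mod_cast hN
  have hi' : (N : ℝ) ≤ i := by exact_mod_cast hi
  have hY : 0 < (N : ℝ) * (N + α - 2) := mul_pos (by linarith) (by linarith)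
  have hE := slEigen_le_mul_slEigen hα hN hi hj hl hμ
  have hE0 := slEigen_nonneg hα.le (show j ≤ i + 1 by omega)
  have hh := jacobiNormSq_le_succ hα hβ hαβ i
  have h1 := jacobiNormSq_pos (a := α - β) (b := β) (by linarith) (by linarith) i
  have h2 := jacobiNormSq_pos (a := β - 1) (b := α - β - 1) (by linarith) (by linarith) (i + 1)
  have hNp : 0 < (N : ℝ) ^ (α - 1) := by positivity
  have hlam' : c * (N : ℝ) ^ (α - 1) ≤ |lam α β i| := by
    refine le_trans ?_ hlam
    gcongr
  have hYp : (((N : ℝ) * (N + α - 2)) ^ (((μ : ℝ) - j) / 2)) ^ 2 =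
      ((N : ℝ) * (N + α - 2)) ^ ((μ : ℝ) - j) := by
    rw [← Real.rpow_natCast, ← Real.rpow_mul hY.le]
    congr 1
    push_cast; ring
  -- Since `K ≥ 1`, `K ≤ K²`. This allows `K` itself, rather than its square root, in `errConst`.
  have hK : (1 : ℝ) ≤ (μ + 1) ^ μ * j ^ j :=
    one_le_mul_of_one_le_of_one_le
      (one_le_pow₀ (by linarith [(Nat.cast_nonneg μ : (0 : ℝ) ≤ μ)]))
      (natCast_one_le_self_pow_self j)
  rw [mul_pow, mul_pow, hYp, errConst, div_pow, Real.rpow_neg (by linarith)]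
  rw [cCoeff]
  have hlam0 : 0 < |lam α β i| := lt_of_lt_of_le (by positivity) hlam'
  have hls : (c * (N : ℝ) ^ (α - 1)) ^ 2 ≤ lam α β i ^ 2 := by
    rw [← sq_abs (lam α β i)]
    gcongr
  generalize lam α β i = L at *
  generalize jacobiNormSq i (α - β) β = h at *
  generalize jacobiNormSq (i + 1) (β - 1) (α - β - 1) = H at *
  generalize fCoeff α β f (i + 1) = F at *
  generalize (N : ℝ) ^ (α - 1) = Q at *
  have hYq : 0 < ((N : ℝ) * (N + α - 2)) ^ ((μ : ℝ) - j) := Real.rpow_pos_of_pos hY _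
  generalize ((N : ℝ) * (N + α - 2)) ^ ((μ : ℝ) - j) = Z at *
  generalize ((μ : ℝ) + 1) ^ μ * (j : ℝ) ^ j = K at *
  generalize slEigen (i + 1) j (α - 2) = E at *
  have hL2 : 0 < L ^ 2 := by rw [← sq_abs]; positivity
  calc (F / (L * H)) ^ 2 * (slEigen i l α * h)
      ≤ (F / (L * H)) ^ 2 * (K * Z * E * H) := by
        refine mul_le_mul_of_nonneg_left ?_ (sq_nonneg _)
        exact mul_le_mul hE hh h1.le (by positivity)
    _ = F ^ 2 / H * E * Z * (K * (1 / L ^ 2)) := by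
        have : L ≠ 0 := by rintro rfl; simp at hL2
        field_simp
    _ ≤ F ^ 2 / H * E * Z * (K ^ 2 * (1 / (c * Q) ^ 2)) := by
        refine mul_le_mul_of_nonneg_left ?_ (by positivity)
        refine mul_le_mul (by nlinarith) ?_ (by positivity) (by positivity)
        exact one_div_le_one_div_of_le (by positivity) hls
    _ = _ := by
        field_simp

/-! ### The error as an `L²` limit of tail polynomials -/

theorem wNorm_congr {a b : ℝ} {u v : ℝ → ℝ} (h : EqOn u v (Ioo 0 1)) :
    wNorm a b u = wNorm a b v := by
  rw [wNorm, wNorm]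
  congr 1
  exact setLIntegral_congr_fun measurableSet_Ioo fun x hx => by simp only [h hx]

theorem rho_neg_mul (a b : ℝ) {x : ℝ} (hx : x ∈ Ioo (0 : ℝ) 1) :
    rho (-a) (-b) x * rho a b x = 1 := by
  rw [← rho_add _ _ _ _ hx, neg_add_cancel, neg_add_cancel]
  simp [rho]

/-- Pointwise `ρ⁻¹ g² = ρ (g/ρ)²`. This turns the convergence defining `q` into convergence of
polynomials in `L²(nu (α-β) β)`. -/
theorem wNorm_neg (a b : ℝ) (g : ℝ → ℝ) :
    wNorm (-a) (-b) g = wNorm a b fun x => g x / rho a b x := by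
  rw [wNorm, wNorm]
  congr 1
  refine setLIntegral_congr_fun measurableSet_Ioo fun x hx => ?_
  have h := rho_neg_mul a b hx
  have h0 := (rho_pos a b hx).ne'
  congr 1
  field_simp
  linear_combination (g x) ^ 2 * h

theorem memWL2_neg_iff (a b : ℝ) (g : ℝ → ℝ) :
    MemWL2 (-a) (-b) g ↔ MemLp (fun x => g x / rho a b x) 2 (nu a b) := by
  rw [← memWL2_iff, MemWL2, MemWL2, wNorm_neg]
  refine and_congr_left fun _ => ⟨fun h => ?_, fun h => ?_⟩
  · simp only [div_eq_mul_inv]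
    exact h.mul (measurable_rho a b).inv.aestronglyMeasurable
  · refine (h.mul (measurable_rho a b).aestronglyMeasurable).congr ?_
    filter_upwards [ae_restrict_mem measurableSet_Ioo] with x hx
    exact div_mul_cancel₀ _ (rho_pos a b hx).ne'

/-- The polynomial `∑_{N ≤ i < N + m} c_i G_i^{(α-β,β)}`. -/
def tailPoly (α β : ℝ) (f : ℝ → ℝ) (N m : ℕ) : Polynomial ℝ :=
  ∑ i ∈ Finset.range m,
    Polynomial.C (cCoeff α β f (N + i)) * jacobiPoly (N + i) (α - β) β

theorem eval_tailPoly (α β : ℝ) (f : ℝ → ℝ) (N m : ℕ) {x : ℝ} (hx : x ∈ Ioo (0 : ℝ) 1) :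
    (tailPoly α β f N m).eval x =
      (qN α β f (N + m) x - qN α β f N x) / rho (α - β) β x := by
  have h0 := (rho_pos (α - β) β hx).ne'
  rw [tailPoly, Polynomial.eval_finsetSum, qN, qN, Finset.sum_range_add]
  simp only [Polynomial.eval_mul, Polynomial.eval_C, eval_jacobiPoly]
  field_simp
  ring

/-- The differentiated tail is an orthogonal series. The termwise comparison and Bessel's inequality
bound its squared partial sums by `(K W)²`, so it converges with norm at most `K W`. -/
theorem exists_limit_derivative_tailPoly {α β c : ℝ} (hα : 1 < α) (hβ : 0 < β)
    (hαβ : 0 < α - β) (hc : 0 < c)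
    (hlam : ∀ i : ℕ, 1 ≤ i → c * (i : ℝ) ^ (α - 1) ≤ |lam α β i|)
    {j l μ N : ℕ} (hN : 1 ≤ N) (hj : j ≤ N + 1) (hl : l ≤ μ) (hμ : μ ≤ j) {f w : ℝ → ℝ}
    (hf : MemLp f 2 (nu (β - 1) (α - β - 1)))
    (hw : MemLp w 2 (nu (β - 1 + j) (α - β - 1 + j))) (hfw : IsWeakDeriv j f w) :
    ∃ y : ℝ → ℝ, MemLp y 2 (nu (α - β + l) (β + l)) ∧
      Tendsto (fun m => eLpNorm (fun x =>
        (Polynomial.derivative^[l] (tailPoly α β f N m)).eval x - y x) 2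
          (nu (α - β + l) (β + l))) atTop (𝓝 0) ∧
      eLpNorm y 2 (nu (α - β + l) (β + l)) ≤
        ENNReal.ofReal (errConst c j μ * (N : ℝ) ^ (-(α - 1)) *
          ((N : ℝ) * (N + α - 2)) ^ (((μ : ℝ) - j) / 2)) *
        eLpNorm w 2 (nu (β - 1 + j) (α - β - 1 + j)) := by
  have hl0 : (0 : ℝ) ≤ l := Nat.cast_nonneg l
  have hN' : (1 : ℝ) ≤ N := by exact_mod_cast hN
  have hY : 0 < (N : ℝ) * (N + α - 2) := mul_pos (by linarith) (by linarith)
  have hK : 0 ≤ errConst c j μ * (N : ℝ) ^ (-(α - 1)) *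
      ((N : ℝ) * (N + α - 2)) ^ (((μ : ℝ) - j) / 2) :=
    mul_nonneg (mul_nonneg (errConst_pos hc j μ).le (by positivity)) (Real.rpow_nonneg hY.le _)
  have hterm := fun i (hi : N ≤ i) =>
    cCoeff_sq_mul_le hα hβ hαβ hc hN hi hj hl hμ (hlam i (hN.trans hi)) f
  set K := errConst c j μ * (N : ℝ) ^ (-(α - 1)) * ((N : ℝ) * (N + α - 2)) ^ (((μ : ℝ) - j) / 2)
  set W := eLpNorm w 2 (nu (β - 1 + j) (α - β - 1 + j))
  have hW : W ≠ ⊤ := hw.2.ne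
  have ha : -1 < α - β := by linarith
  have hb : -1 < β := by linarith
  set P : ℕ → Polynomial ℝ := fun i => Polynomial.C (cCoeff α β f (N + i)) *
    Polynomial.derivative^[l] (jacobiPoly (N + i) (α - β) β) with hP
  have hPsum : ∀ m, Polynomial.derivative^[l] (tailPoly α β f N m) = ∑ i ∈ Finset.range m, P i :=
    fun m => by
      rw [tailPoly, Polynomial.iterate_derivative_sum]
      exact Finset.sum_congr rfl fun i _ => Polynomial.iterate_derivative_C_mul _ _ _
  have hPP : ∀ i k, wInt (α - β + l) (β + l) (P i * P k) = cCoeff α β f (N + i) *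
      (cCoeff α β f (N + k) * wInt (α - β + l) (β + l)
        (Polynomial.derivative^[l] (jacobiPoly (N + i) (α - β) β) *
          Polynomial.derivative^[l] (jacobiPoly (N + k) (α - β) β))) := fun i k => by
    rw [hP, mul_mul_mul_comm, ← Polynomial.C_mul, wInt_C_mul, mul_assoc]
  obtain ⟨y, hy, hlim, hn⟩ := exists_tendsto_sum_eval (a := α - β + l) (b := β + l) (by linarith)
    (by linarith) (P := P) (fun i k hik => by
      rw [hPP, wInt_iterate_derivative_jacobiPoly_of_ne ha hb l (by omega), mul_zero, mul_zero])
    -- Bessel is applied at the indices `N + i + 1`, because `c_i` involves the moment `f_{i+1}`.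
    (S := K * W.toReal) (by positivity) fun m => by
      have hbess := sum_slEigen_mul_sq_div_le hfw (by linarith) (by linarith) hf hw
        ((Finset.range m).image fun i => N + i + 1)
      rw [Finset.sum_image (by intro i _ k _ h; simpa using h)] at hbess
      rw [mul_pow]
      refine le_trans ?_ (mul_le_mul_of_nonneg_left hbess (sq_nonneg K))
      rw [Finset.mul_sum]
      refine Finset.sum_le_sum fun i _ => ?_
      have h1 := hterm (N + i) (Nat.le_add_right N i)
      rw [hPP, wInt_iterate_derivative_mul ha hb, ← jacobiNormSq_eq_wInt, ← mul_assoc, ← sq,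
        sub_add_cancel, show β - 1 + (α - β - 1) = α - 2 by ring]
      exact h1
  refine ⟨y, hy, by simpa only [hPsum] using hlim, hn.trans (le_of_eq ?_)⟩
  rw [ENNReal.ofReal_mul hK, ENNReal.ofReal_toReal hW]

theorem isWeakDeriv_zero {v : ℝ → ℝ} (h : LocallyIntegrableOn v (Ioo 0 1)) :
    IsWeakDeriv 0 v v :=
  ⟨h, h, fun φ _ _ _ => by simp⟩

theorem exists_isSpectralLimit {α β c : ℝ} (hα : 1 < α) (hβ : 0 < β)
    (hαβ : 0 < α - β) (hc : 0 < c)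
    (hlam : ∀ i : ℕ, 1 ≤ i → c * (i : ℝ) ^ (α - 1) ≤ |lam α β i|) {f : ℝ → ℝ}
    (hf : MemLp f 2 (nu (β - 1) (α - β - 1))) : ∃ q, IsSpectralLimit α β f q := by
  have ha : -1 < α - β := by linarith
  have hb : -1 < β := by linarith
  -- With all orders zero, `f` serves as its own weak derivative. The series is started at `N = 1`,
  -- where the lower bound on `λ_i` begins, and `q_1` is added back afterwards.
  obtain ⟨y, hy, hlim, -⟩ := exists_limit_derivative_tailPoly hα hβ hαβ hc hlam (j := 0) (l := 0)
    (μ := 0) (N := 1) le_rfl (by omega) le_rfl le_rfl hf (by simpa using hf)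
    (isWeakDeriv_zero (locallyIntegrableOn_of_memLp_nu (by linarith) (by linarith) hf))
  simp only [Nat.cast_zero, add_zero, Function.iterate_zero, id_eq] at hy hlim
  refine ⟨fun x => qN α β f 1 x + rho (α - β) β x * y x, ?_, ?_⟩
  · rw [memWL2_neg_iff]
    have h := (memLp_eval ha hb (tailPoly α β f 0 1)).add hy
    refine h.ae_eq ((nu_absolutelyContinuous _ _).ae_le ?_)
    filter_upwards [ae_restrict_mem measurableSet_Ioo] with x hx
    have h0 := (rho_pos (α - β) β hx).ne'
    rw [Pi.add_apply, eval_tailPoly α β f 0 1 hx]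
    simp only [qN, Finset.range_zero, Finset.sum_empty, zero_add]
    field_simp
    ring
  · rw [← tendsto_add_atTop_iff_nat 1]
    refine hlim.congr fun m => ?_
    rw [wNorm_neg, ← wNorm_eq_eLpNorm]
    refine wNorm_congr fun x hx => ?_
    have h0 := (rho_pos (α - β) β hx).ne'
    beta_reduce
    rw [eval_tailPoly α β f 1 m hx, add_comm m 1]
    field_simp
    ring

theorem sobolevNorm_error_le {α β c : ℝ} (hα : 1 < α) (hβ : 0 < β)
    (hαβ : 0 < α - β) (hc : 0 < c)
    (hlam : ∀ i : ℕ, 1 ≤ i → c * (i : ℝ) ^ (α - 1) ≤ |lam α β i|)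
    {j μ N : ℕ} (hN : 1 ≤ N) (hj : j ≤ N + 1) (hμ : μ ≤ j) {f w q : ℝ → ℝ}
    (hf : MemLp f 2 (nu (β - 1) (α - β - 1)))
    (hw : MemLp w 2 (nu (β - 1 + j) (α - β - 1 + j))) (hfw : IsWeakDeriv j f w)
    (hq : IsSpectralLimit α β f q) :
    sobolevNorm μ (α - β) β (fun x => (q x - qN α β f N x) / rho (α - β) β x) ≤
      ENNReal.ofReal ((μ + 1) * errConst c j μ * (N : ℝ) ^ (-(α - 1)) *
        ((N : ℝ) * (N + α - 2)) ^ (((μ : ℝ) - j) / 2)) *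
      wNorm (β - 1 + j) (α - β - 1 + j) w := by
  have ha : -1 < α - β := by linarith
  have hb : -1 < β := by linarith
  set v : ℝ → ℝ := fun x => (q x - qN α β f N x) / rho (α - β) β x with hv
  have hvm : MemLp v 2 (nu (α - β) β) := by
    have h := ((memWL2_neg_iff _ _ _).1 hq.1).sub (memLp_eval ha hb (tailPoly α β f 0 N))
    refine h.ae_eq ((nu_absolutelyContinuous _ _).ae_le ?_)
    filter_upwards [ae_restrict_mem measurableSet_Ioo] with x hx
    have h0 := (rho_pos (α - β) β hx).ne'
    rw [Pi.sub_apply, eval_tailPoly α β f 0 N hx, hv, zero_add]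
    simp only [qN, Finset.range_zero, Finset.sum_empty]
    field_simp
    ring
  have hvlim : Tendsto (fun m => eLpNorm (fun x => (tailPoly α β f N m).eval x - v x) 2
      (nu (α - β) β)) atTop (𝓝 0) := by
    refine ((tendsto_add_atTop_iff_nat N).2 hq.2).congr fun m => ?_
    rw [wNorm_neg, ← wNorm_eq_eLpNorm]
    refine wNorm_congr fun x hx => ?_
    have h0 := (rho_pos (α - β) β hx).ne'
    rw [eval_tailPoly α β f N m hx, hv, add_comm m N]
    field_simp
    ring
  rw [wNorm_eq_eLpNorm]
  set W := eLpNorm w 2 (nu (β - 1 + j) (α - β - 1 + j))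
  set K := errConst c j μ * (N : ℝ) ^ (-(α - 1)) * ((N : ℝ) * (N + α - 2)) ^ (((μ : ℝ) - j) / 2)
    with hKdef
  have hsemi : ∀ l ∈ Finset.range (μ + 1),
      wSeminorm l (α - β) β v ^ 2 ≤ (ENNReal.ofReal K * W) ^ 2 := by
    intro l hl
    have hl' : l ≤ μ := by have := Finset.mem_range.1 hl; omega
    have hl0 : (0 : ℝ) ≤ l := Nat.cast_nonneg l
    obtain ⟨y, hy, hlim, hn⟩ := exists_limit_derivative_tailPoly hα hβ hαβ hc hlam hN hj hl' hμ
      hf hw hfw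
    have hwd : IsWeakDeriv l v y :=
      isWeakDeriv_of_tendsto ha hb (by linarith) (by linarith) hvm hy hvlim hlim
    refine pow_le_pow_left₀ zero_le ?_ 2
    -- The seminorm is an infimum, so one weak derivative with the right norm suffices.
    refine (iInf₂_le y hwd).trans ?_
    rw [wNorm_eq_eLpNorm]
    exact hn
  -- The `μ + 1` seminorms share one bound, and `μ + 1 ≤ (μ + 1)²` brings this count inside the
  -- square.
  have hμ1 : (μ + 1 : ℕ) • (ENNReal.ofReal K * W) ^ 2 ≤
      (ENNReal.ofReal ((μ + 1) * K) * W) ^ 2 := by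
    rw [ENNReal.ofReal_mul (show (0 : ℝ) ≤ μ + 1 by positivity), mul_assoc]
    generalize ENNReal.ofReal K * W = A
    rw [mul_pow, nsmul_eq_mul]
    refine mul_le_mul_of_nonneg_right ?_ zero_le
    have e : ENNReal.ofReal ((μ : ℝ) + 1) = ((μ + 1 : ℕ) : ℝ≥0∞) := by
      rw [← Nat.cast_succ, ENNReal.ofReal_natCast]
    rw [e]
    exact_mod_cast Nat.le_self_pow (by norm_num) (μ + 1)
  have hsum : ∑ l ∈ Finset.range (μ + 1), wSeminorm l (α - β) β v ^ 2 ≤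
      (ENNReal.ofReal ((μ + 1) * K) * W) ^ 2 := by
    refine le_trans ?_ hμ1
    simpa using Finset.sum_le_card_nsmul _ _ _ hsemi
  have e : ((μ : ℝ) + 1) * errConst c j μ * (N : ℝ) ^ (-(α - 1)) *
      ((N : ℝ) * (N + α - 2)) ^ (((μ : ℝ) - j) / 2) = (μ + 1) * K := by
    rw [hKdef]; ring
  rw [e, sobolevNorm]
  refine (ENNReal.rpow_le_rpow hsum (by norm_num)).trans (le_of_eq ?_)
  rw [← ENNReal.rpow_natCast, ← ENNReal.rpow_mul]
  norm_num

end

end FracSpectral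

/-! ### The error estimate -/

theorem mainTheorem4 (r : ℝ) (hr : 1 / 2 ≤ r) (hr1 : r ≤ 1)
    (α₀ : ℝ) (hα₀ : 1 ≤ α₀) (hrα₀ : r = 1 / 2 → 1 < α₀)
    (j μ : ℕ) (hμ : μ ≤ j) :
    ∃ C : ℝ, 0 < C ∧
      ∀ α β : ℝ, 1 < α → α < 2 → α₀ ≤ α → α - 1 ≤ β → β ≤ 1 →
        r = Real.sin (Real.pi * β) /
          (Real.sin (Real.pi * (α - β)) + Real.sin (Real.pi * β)) →
      ∀ f : ℝ → ℝ, FracSpectral.MemWL2 (β - 1) (α - β - 1) f →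
        (∃ g : ℝ → ℝ, FracSpectral.IsWeakDeriv j f g ∧
          FracSpectral.MemWL2 (β + j - 1) (α - β + j - 1) g) →
        (∃ q : ℝ → ℝ, FracSpectral.IsSpectralLimit α β f q) ∧
        ∀ q : ℝ → ℝ, FracSpectral.IsSpectralLimit α β f q →
          ∀ N : ℕ, 1 ≤ N → j ≤ N + 1 →
            FracSpectral.sobolevNorm μ (α - β) β
                (fun x => (q x - FracSpectral.qN α β f N x) / FracSpectral.rho (α - β) β x) ≤
              ENNReal.ofReal (C * (N : ℝ) ^ (-(α - 1)) *
                  ((N : ℝ) * (N + α - 2)) ^ (((μ : ℝ) - j) / 2)) *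
                FracSpectral.wSeminorm j (β - 1) (α - β - 1) f := by
  open FracSpectral in
  obtain ⟨c, hc, hlam⟩ := exists_lam_lower_bound hr hα₀ hrα₀
  refine ⟨(μ + 1) * errConst c j μ, mul_pos (by positivity) (errConst_pos hc j μ),
    fun α β h1 h2 hα hβ hβ' he f hf _ => ?_⟩
  have hβ0 : 0 < β := by linarith
  have hαβ : 0 < α - β := by linarith
  have hlam' := hlam α β h1 h2 hα hβ hβ' he
  have hf' := (memWL2_iff _ _ _).1 hf
  refine ⟨exists_isSpectralLimit h1 hβ0 hαβ hc hlam' hf', fun q hq N hN hj => ?_⟩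
  have hN' : (1 : ℝ) ≤ N := by exact_mod_cast hN
  have hY : 0 < (N : ℝ) * (N + α - 2) := mul_pos (by linarith) (by linarith)
  have hK : 0 < (μ + 1) * errConst c j μ * (N : ℝ) ^ (-(α - 1)) *
      ((N : ℝ) * (N + α - 2)) ^ (((μ : ℝ) - j) / 2) :=
    mul_pos (mul_pos (mul_pos (by positivity) (errConst_pos hc j μ)) (by positivity))
      (Real.rpow_pos_of_pos hY _)
  have hK' := (ENNReal.ofReal_pos.2 hK).ne'
  -- The constant is nonzero and finite, so it passes inside both infima and the estimate is proved
  -- for each weak derivative `w`. If `w` has infinite norm, the right side is `⊤`.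
  rw [wSeminorm, ENNReal.mul_iInf_of_ne hK' ENNReal.ofReal_ne_top]
  refine le_iInf fun w => ?_
  rw [ENNReal.mul_iInf_of_ne hK' ENNReal.ofReal_ne_top]
  refine le_iInf fun hw => ?_
  rcases eq_or_ne (wNorm (β - 1 + j) (α - β - 1 + j) w) ⊤ with h | h
  · rw [h, ENNReal.mul_top hK']
    exact le_top
  · exact sobolevNorm_error_le h1 hβ0 hαβ hc hlam' hN hj hμ hf'
      ((memWL2_iff _ _ _).1 ⟨hw.2.1.aestronglyMeasurable, lt_top_iff_ne_top.2 h⟩) hw hq
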